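/- **Setting.** Let $d\ge 0$, $\gamma\in(0,1)$, and let $N$ be the largest natural number with $\gamma N\le 1$. Let $\mathcal T$ be the set of (non-empty, non-planar) rooted trees with nodes decorated by $\{0,\dots,d\}$; $|\tau|$ is the number of nodes of $\tau\in\mathcal T$, $|\tau|_0$ the number of its nodes decorated by $0$, and $\gamma_\tau:=(1-\gamma)|\tau|_0+\gamma|\tau|$. Let $\mathcal H$ be the real vector space spanned by the forests (finite multisets of trees), with the forest product, unit $\mathbf 1$ (the empty forest), and the Butcher–Connes–Kreimer coproduct $\Delta$, i.e. the algebra morphism with $\Delta\tau=\mathbf 1\otimes\tau+(B_+^i\otimes\mathrm{id})\Delta(\tau_1\cdots\tau_n)$ for $\tau=B_+^i(\tau_1\cdots\tau_n)$, where $B_+^i$ connects the roots to a new root decorated by $i$. Let $\mathcal H_N\subset\mathcal H$ be the span of the forests with at most $N$ nodes, and $\mathcal H_N^*$ its dual with the product $X\star Y=(X\otimes Y)\Delta$ and unit $\mathbf 1^*$. A tree is regarded as the element of $\mathcal H_N^*$ equal to $1$ at that tree and $0$ at all other forests. Let $\mathcal B_N$ be a set of linear combinations of trees with at most $N$ nodes,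 each homogeneous (its trees share the same $|\cdot|$ and the same $|\cdot|_0$, so that $|b|$, $|b|_0$ and $\gamma_b:=(1-\gamma)|b|_0+\gamma|b|$ make sense for $b\in\mathcal B_N$), such that the products $b_1\star\cdots\star b_n$ ($n\ge0$, $b_i\in\mathcal B_N$, $\sum_i|b_i|\le N$) form a basis of $\mathcal H_N^*$. Let $T_N(\mathcal B_N)$ be the span of the words $b_1\otimes\cdots\otimes b_n$ in the alphabet $\mathcal B_N$ with $\sum_i|b_i|\le N$, with the concatenation product (words with $\sum_i|b_i|>N$ are set to $0$) and unit the empty word $\varepsilon$. Let $\Psi:\mathcal H_N^*\to T_N(\mathcal B_N)$ be the linear isomorphism $b_1\star\cdots\star b_n\mapsto b_1\otimes\cdots\otimes b_n$. Let $M:\mathcal H\to\mathcal H$ be linear, multiplicative for the forest product, with $M\mathbf 1=\mathbf 1$ and $(M\otimes M)\Delta=\Delta M$, and such that for every $\tau\in\mathcal T$, $M\tau$ is a linear combination of trees $\sigma$ with $\gamma_\sigma\ge\gamma_\tau$ and $|\sigma|\le|\tau|$. Then $M$ maps $\mathcal H_N$ to itself; let $M^*:\mathcal H_N^*\to\mathcal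 H_N^*$ be the adjoint of this restriction. An anisotropic $\gamma$-rough path on $T_N(\mathcal B_N)$ is a family $X=(X_{st})_{s,t\in[0,1]}$ of elements of $T_N(\mathcal B_N)$ such that, writing $\langle X_{st},w\rangle$ for the coefficient of the word $w$: (i) $X_{st}$ is a character of the truncated shuffle algebra, i.e. $\langle X_{st},\varepsilon\rangle=1$ and $\langle X_{st},u\sqcup\!\sqcup v\rangle=\langle X_{st},u\rangle\langle X_{st},v\rangle$ for all words $u,v$ whose letters have at most $N$ nodes in total, where $\sqcup\!\sqcup$ is the shuffle product; (ii) $X_{tt}=\varepsilon$; (iii) $\sum_{w=uv}\langle X_{sr},u\rangle\langle X_{rt},v\rangle=\langle X_{st},w\rangle$ for all $s,r,t\in[0,1]$ and all words $w$ of $T_N(\mathcal B_N)$ (Chen's relation); (iv) for every word $w=b_1\otimes\cdots\otimes b_n$ of $T_N(\mathcal B_N)$ there is $C$ with $|\langle X_{st},w\rangle|\le C|t-s|^{\gamma_{b_1}+\dots+\gamma_{b_n}}$ for all $s,t\in[0,1]$. **Proposition.** There is exactly one linear map $\tilde M^*:T_N(\mathcal B_N)\to T_N(\mathcal B_N)$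 which is multiplicative for concatenation, i.e. $\tilde M^*\varepsilon=\varepsilon$ and $\tilde M^*(xy)=(\tilde M^*x)(\tilde M^*y)$ for all $x,y\in T_N(\mathcal B_N)$, and satisfies $$\tilde M^*b=\Psi(M^*b)\qquad\text{for all letters } b\in\mathcal B_N .$$ This map satisfies $$\Psi\circ M^*=\tilde M^*\circ\Psi ,$$ it is the only linear map on $T_N(\mathcal B_N)$ with this property, and for every anisotropic $\gamma$-rough path $X$ on $T_N(\mathcal B_N)$, the family $\tilde M^*X=(\tilde M^*X_{st})_{s,t\in[0,1]}$ is again an anisotropic $\gamma$-rough path on $T_N(\mathcal B_N)$. -/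

import Mathlib

open scoped TensorProduct

noncomputable section

namespace BranchedRP

/-! ### Decorated non-planar rooted trees -/

/-- The functor `X ↦ {0, …, d} × (finite multisets in X)`: a rooted tree is given by the decoration
of its root and the multiset of the subtrees attached to the root. -/
def TreeF (d : ℕ) (X : Type) : Type := Fin (d + 1) × Multiset X

/-- `TreeF d` is a quotient of a polynomial functor (lists modulo permutation), so that its initial
algebra exists. -/
instance treeFQPF (d : ℕ) : QPF (TreeF d) where
  map f x := (x.1, x.2.map f)
  P := ⟨Fin (d + 1) × ℕ, fun a => Fin a.2⟩
  abs p := (p.1.1, (List.ofFn p.2 : Multiset _))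
  repr x := ⟨(x.1, x.2.toList.length), fun k => x.2.toList.get k⟩
  abs_repr := by
    rintro α ⟨i, m⟩
    change (i, (List.ofFn m.toList.get : Multiset α)) = (i, m)
    rw [List.ofFn_get, Multiset.coe_toList]
  abs_map := by
    rintro α β f ⟨⟨i, n⟩, g⟩
    change (i, (List.ofFn (f ∘ g) : Multiset β)) = (i, Multiset.map f (List.ofFn g : Multiset α))
    rw [Multiset.map_coe, List.map_ofFn]

/-- The set of (non-empty) non-planar rooted trees with nodes decorated by `{0, …, d}`: the initial
algebra of `X ↦ {0, …, d} × (finite multisets in X)`. -/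
def DTree (d : ℕ) : Type := QPF.Fix (TreeF d)

variable {d : ℕ}

namespace DTree

/-- The tree whose root has decoration `i` and to whose root the trees in `m` are attached. -/
def node (i : Fin (d + 1)) (m : Multiset (DTree d)) : DTree d :=
  QPF.Fix.mk (F := TreeF d) (i, m)

/-- Structural recursion on trees: `(fold g) (node i m) = g i (m.map (fold g))`. -/
def fold {α : Type} (g : Fin (d + 1) → Multiset α → α) : DTree d → α :=
  QPF.Fix.rec (F := TreeF d) fun x => g x.1 x.2

theorem fold_node {α : Type} (g : Fin (d + 1) → Multiset α → α) (i : Fin (d + 1))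
    (m : Multiset (DTree d)) : fold g (node i m) = g i (m.map (fold g)) :=
  QPF.Fix.rec_eq (F := TreeF d) (fun x => g x.1 x.2) (i, m)

theorem node_inj {i j : Fin (d + 1)} {m n : Multiset (DTree d)} :
    node i m = node j n ↔ i = j ∧ m = n := by
  constructor
  · intro h
    have h' := congrArg (QPF.Fix.dest (F := TreeF d)) h
    have h₁ := QPF.Fix.dest_mk (F := TreeF d) (i, m)
    have h₂ := QPF.Fix.dest_mk (F := TreeF d) (j, n)
    exact Prod.mk.inj (h₁.symm.trans (h'.trans h₂))
  · rintro ⟨rfl, rfl⟩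
    rfl

/-- Structural induction on trees. -/
theorem induction {p : DTree d → Prop}
    (h : ∀ (i : Fin (d + 1)) (m : Multiset (DTree d)), (∀ τ ∈ m, p τ) → p (node i m)) (τ : DTree d) :
    p τ := by
  refine QPF.Fix.ind (F := TreeF d) p ?_ τ
  rintro x ⟨u, rfl⟩
  refine h _ _ fun σ hσ => ?_
  obtain ⟨y, -, rfl⟩ := Multiset.mem_map.1 hσ
  exact y.2

/-- `|τ|`, the number of nodes of `τ`. -/
def size : DTree d → ℕ := fold fun _ m => 1 + m.sum

/-- `|τ|₀`, the number of nodes of `τ` with decoration `0`. -/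
def zeros : DTree d → ℕ := fold fun i m => (if i = 0 then 1 else 0) + m.sum

theorem size_node (i : Fin (d + 1)) (m : Multiset (DTree d)) :
    size (node i m) = 1 + (m.map size).sum := fold_node _ i m

theorem zeros_node (i : Fin (d + 1)) (m : Multiset (DTree d)) :
    zeros (node i m) = (if i = 0 then 1 else 0) + (m.map zeros).sum := fold_node _ i m

end DTree

/-! ### The Butcher-Connes-Kreimer Hopf algebra -/

/-- Forests: finite multisets of trees, written as multiplicity functions. -/
abbrev Forest (d : ℕ) : Type := DTree d →₀ ℕ

/-- The number of nodes of a forest. -/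
def forestSize (f : Forest d) : ℕ := f.sum fun τ n => n * τ.size

/-- The algebra `H`: the linear span of the forests with the forest product, that is, the
polynomial algebra in the trees. -/
abbrev H (d : ℕ) : Type := MvPolynomial (DTree d) ℝ

/-- A tree as an element of `H`. -/
def tree (τ : DTree d) : H d := MvPolynomial.X τ

/-- The operator `B₊ⁱ : H → H`, connecting the roots of the trees of a forest to a new root with
decoration `i`. -/
def Bplus (i : Fin (d + 1)) : H d →ₗ[ℝ] H d :=
  (MvPolynomial.basisMonomials (DTree d) ℝ).constr ℝ fun f => tree (.node i (Finsupp.toMultiset f))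

/-- The Butcher-Connes-Kreimer coproduct of a tree, see `coproductTree_node`. The recursion carries
the tree itself along, since the recursive formula refers to it. -/
def coproductTree (τ : DTree d) : H d ⊗[ℝ] H d :=
  (DTree.fold (α := DTree d × (H d ⊗[ℝ] H d))
    (fun i m => (DTree.node i (m.map Prod.fst),
      1 ⊗ₜ[ℝ] tree (DTree.node i (m.map Prod.fst))
        + (Bplus i).rTensor (H d) (m.map Prod.snd).prod)) τ).2

/-- The coproduct `Δ : H → H ⊗ H`, extended multiplicatively to forests. -/
def coproduct (d : ℕ) : H d →ₐ[ℝ] H d ⊗[ℝ] H d := MvPolynomial.aeval coproductTree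

/-- `Δ τ = 1 ⊗ τ + (B₊ⁱ ⊗ id) Δ(τ₁ ⋯ τₙ)` for `τ = B₊ⁱ(τ₁ ⋯ τₙ)`. -/
theorem coproduct_node (i : Fin (d + 1)) (m : Multiset (DTree d)) :
    coproduct d (tree (.node i m)) = 1 ⊗ₜ[ℝ] tree (.node i m)
      + (Bplus i).rTensor (H d) (coproduct d (m.map tree).prod) := by
  have key : ∀ τ : DTree d, (DTree.fold (α := DTree d × (H d ⊗[ℝ] H d))
      (fun i m => (DTree.node i (m.map Prod.fst),
        1 ⊗ₜ[ℝ] tree (DTree.node i (m.map Prod.fst))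
          + (Bplus i).rTensor (H d) (m.map Prod.snd).prod)) τ).1 = τ := by
    intro τ
    induction τ using DTree.induction with
    | h i m ih =>
      rw [DTree.fold_node]
      simp only [Multiset.map_map, Function.comp_apply]
      congr 1
      exact (Multiset.map_congr rfl ih).trans (Multiset.map_id' m)
  have hc : ∀ τ : DTree d, coproduct d (tree τ) = coproductTree τ := fun τ => by
    simp [coproduct, tree]
  rw [hc, map_multiset_prod, Multiset.map_map]
  simp only [Function.comp_def, hc]
  conv_lhs => unfold coproductTree
  rw [DTree.fold_node]
  simp only [Multiset.map_map, Function.comp_apply, key, Multiset.map_id']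
  rfl

/-! ### Truncation, the dual, and the convolution product -/

/-- `H_N`, the linear span of the forests with at most `N` nodes. -/
def HN (d N : ℕ) : Submodule ℝ (H d) :=
  Submodule.span ℝ {x | ∃ f : Forest d, forestSize f ≤ N ∧ x = MvPolynomial.monomial f 1}

open Classical in
/-- The projection `H → H_N` which kills the forests with more than `N` nodes. -/
def proj (d N : ℕ) : H d →ₗ[ℝ] HN d N :=
  (MvPolynomial.basisMonomials (DTree d) ℝ).constr ℝ fun f =>
    if h : forestSize f ≤ N then ⟨MvPolynomial.monomial f 1, Submodule.subset_span ⟨f, h, rfl⟩⟩ else 0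

/-- The dual `H_N^*`. -/
abbrev HNdual (d N : ℕ) : Type := Module.Dual ℝ (HN d N)

/-- The convolution product `X ⋆ Y = (X ⊗ Y) Δ` on `H_N^*`. (As `Δ` maps `H_N` to `H_N ⊗ H_N`, the
projections only serve to extend `X` and `Y` to `H`.) -/
def conv {N : ℕ} (X Y : HNdual d N) : HNdual d N :=
  LinearMap.mul' ℝ ℝ ∘ₗ TensorProduct.map (X ∘ₗ proj d N) (Y ∘ₗ proj d N) ∘ₗ
    (coproduct d).toLinearMap ∘ₗ (HN d N).subtype

/-- The counit `𝟏^*`, the unit of `⋆`: it is `1` at the empty forest and `0` at all others. -/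
def counit (d N : ℕ) : HNdual d N := MvPolynomial.lcoeff ℝ (0 : Forest d) ∘ₗ (HN d N).subtype

/-- A tree as an element of `H_N^*`: it is `1` at the forest consisting of this tree only, and `0`
at all other forests. -/
def dualTree (N : ℕ) (τ : DTree d) : HNdual d N :=
  MvPolynomial.lcoeff ℝ (Finsupp.single τ 1) ∘ₗ (HN d N).subtype

/-- A linear combination of trees as an element of `H_N^*`. -/
def toDual (N : ℕ) : (DTree d →₀ ℝ) →ₗ[ℝ] HNdual d N :=
  Finsupp.linearCombination ℝ (dualTree N)

/-! ### Renormalisation maps -/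

/-- The exponent `(1 - γ) z + γ n` of an object with `n` nodes, `z` of which are decorated by `0`.
For `z = 0` this is `γ n`. -/
def exponent (γ : ℝ) (n z : ℕ) : ℝ := (1 - γ) * z + γ * n

/-- `γ_τ`. -/
def DTree.exponent (γ : ℝ) (τ : DTree d) : ℝ := BranchedRP.exponent γ τ.size τ.zeros

/-- The renormalisation maps `M : H → H`: linear, multiplicative for the forest product, with
`M 𝟏 = 𝟏` (these three as `M` is an algebra morphism), satisfying the cointeraction property
`(M ⊗ M) Δ = Δ M`, and sending each tree `τ` to a linear combination of trees `σ` with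
`γ_σ ≥ γ_τ` and `|σ| ≤ |τ|`. -/
structure IsRenormalisation (γ : ℝ) (M : H d →ₐ[ℝ] H d) : Prop where
  cointeraction : (Algebra.TensorProduct.map M M).comp (coproduct d) = (coproduct d).comp M
  analytic : ∀ τ : DTree d, M (tree τ) ∈
    Submodule.span ℝ {x | ∃ σ : DTree d, τ.exponent γ ≤ σ.exponent γ ∧ σ.size ≤ τ.size ∧ x = tree σ}

/-- The adjoint `M^* : H_N^* → H_N^*` of (the truncation to `H_N` of) `M`. -/
def adjoint (N : ℕ) (M : H d →ₐ[ℝ] H d) : HNdual d N →ₗ[ℝ] HNdual d N :=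
  (proj d N ∘ₗ M.toLinearMap ∘ₗ (HN d N).subtype).dualMap

/-! ### Letters and words -/

/-- The number of nodes `|b|` of a homogeneous linear combination of trees. -/
def deg (b : DTree d →₀ ℝ) : ℕ := b.support.sup DTree.size

/-- The number of nodes `|b|₀` with decoration `0` of a homogeneous linear combination of trees. -/
def zdeg (b : DTree d →₀ ℝ) : ℕ := b.support.sup DTree.zeros

/-- `b` is homogeneous: all its trees have the same `|·|` and the same `|·|₀`. -/
def IsHomogeneous (b : DTree d →₀ ℝ) : Prop :=
  ∀ τ ∈ b.support, τ.size = deg b ∧ τ.zeros = zdeg b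

variable {B : Set (DTree d →₀ ℝ)}

/-- The number of nodes of a word. -/
def wordSize (w : List B) : ℕ := (w.map fun b => deg b.1).sum

/-- The exponent of a word: the sum of the exponents of its letters. -/
def wordExponent (γ : ℝ) (w : List B) : ℝ := (w.map fun b => exponent γ (deg b.1) (zdeg b.1)).sum

/-- The words in the alphabet `B` with at most `N` nodes. -/
abbrev Word (B : Set (DTree d →₀ ℝ)) (N : ℕ) : Type := {w : List B // wordSize w ≤ N}

/-- `τ₁ ⋆ ⋯ ⋆ τₙ` in `H_N^*` for a word `τ₁ ⊗ ⋯ ⊗ τₙ`. -/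
def starWord {N : ℕ} (w : Word B N) : HNdual d N :=
  (w.1.map fun b => toDual N b.1).foldr conv (counit d N)

/-- `B` is a basis `B_N`: it consists of homogeneous linear combinations of trees with at most `N`
nodes, and every element of `H_N^*` has a unique representation `∑ λ_R τ_{r₁} ⋆ ⋯ ⋆ τ_{rₙ}` over the
words in `B` with at most `N` nodes. -/
structure IsStarBasis (B : Set (DTree d →₀ ℝ)) (N : ℕ) : Prop where
  homogeneous : ∀ b ∈ B, IsHomogeneous b
  deg_le : ∀ b ∈ B, deg b ≤ N
  linearIndependent : LinearIndependent ℝ (starWord : Word B N → HNdual d N)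
  spans : ⊤ ≤ Submodule.span ℝ (Set.range (starWord : Word B N → HNdual d N))

/-- `T_N(B_N)`: the linear span of the words with at most `N` nodes. -/
abbrev TN (B : Set (DTree d →₀ ℝ)) (N : ℕ) : Type := Word B N →₀ ℝ

/-- The isomorphism `Ψ : H_N^* → T_N(B_N)`, `τ₁ ⋆ ⋯ ⋆ τₙ ↦ τ₁ ⊗ ⋯ ⊗ τₙ`. -/
def Psi {N : ℕ} (hB : IsStarBasis B N) : HNdual d N ≃ₗ[ℝ] TN B N :=
  (Module.Basis.mk hB.linearIndependent hB.spans).repr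

namespace TN

variable {N : ℕ}

/-- `⟨x, w⟩`, the coefficient of the word `w` in `x` (zero when `w` has more than `N` nodes). -/
def pair (x : TN B N) (w : List B) : ℝ := if h : wordSize w ≤ N then x ⟨w, h⟩ else 0

/-- A word as an element of `T_N(B_N)` (zero when it has more than `N` nodes). -/
def word (N : ℕ) (w : List B) : TN B N :=
  if h : wordSize w ≤ N then Finsupp.single ⟨w, h⟩ 1 else 0

/-- The concatenation product of `T_N(B_N)`; words with more than `N` nodes are discarded. -/
def concat (x y : TN B N) : TN B N :=
  x.sum fun u a => y.sum fun v c => (a * c) • word N (u.1 ++ v.1)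

end TN

/-- The shuffle product of two words, as a multiset of words. -/
def shuffle {A : Type*} : List A → List A → Multiset (List A)
  | [], v => {v}
  | a :: u, [] => {a :: u}
  | a :: u, b :: v =>
    (shuffle u (b :: v)).map (List.cons a) + (shuffle (a :: u) v).map (List.cons b)
  termination_by u v => u.length + v.length

/-! ### Anisotropic rough paths -/

/-- Anisotropic `γ`-rough paths with values in the characters of `T_N(B_N)` with the shuffle
product. A functional on `T_N(B_N)` is identified with the element of `T_N(B_N)` whose coefficients
are its values on words. -/
structure IsARP {N : ℕ} (γ : ℝ) (X : unitInterval → unitInterval → TN B N) : Prop where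
  /-- Characters are unital. -/
  unit : ∀ s t, (X s t).pair [] = 1
  /-- Characters are multiplicative for the shuffle product. -/
  mul : ∀ s t, ∀ u v : List B, wordSize u + wordSize v ≤ N →
    ((shuffle u v).map (X s t).pair).sum = (X s t).pair u * (X s t).pair v
  /-- `X_{tt}` is the counit. -/
  diag : ∀ t, X t t = TN.word N []
  /-- Chen's relation `X_{su} * X_{ut} = X_{st}`, where `*` is the convolution with respect to the
  deconcatenation of words. -/
  chen : ∀ s u t, ∀ w : List B, wordSize w ≤ N →
    ∑ k ∈ Finset.range (w.length + 1), (X s u).pair (w.take k) * (X u t).pair (w.drop k)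
      = (X s t).pair w
  /-- The analytic bounds. -/
  bound : ∀ w : List B, wordSize w ≤ N → ∃ C : ℝ, ∀ s t : unitInterval,
    |(X s t).pair w| ≤ C * |(t : ℝ) - s| ^ wordExponent γ w

end BranchedRP

end

/-!
Let `A` be the dual of the whole Hopf algebra `H`, with the convolution `X * Y = (X ⊗ Y) Δ`. The
coproduct is coassociative and counital (`coproduct_coassoc`, `counit_coproduct`,
`coproduct_counit`, by induction on trees), so `A` is a unital algebra, and the restriction
`A → H_N^*` is multiplicative (`restrict_convolve`) because `Δ` preserves the number of nodes. Both
gradings are handled through the dilations `τ ↦ a ^ |τ| b ^ |τ|₀ τ`: they are morphisms of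
bialgebras, just like `M`, so that both are covered by `convolve_comp`, which says that
precomposition with a morphism of bialgebras is multiplicative.

It follows that `Ψ` and `M^*` are multiplicative (`Psi_conv`, `adjoint_conv`), and the required map
is `Ψ ∘ M^* ∘ Ψ⁻¹` (`translation`). It is unique because a multiplicative map is determined by its
values on letters, and because `Ψ` is surjective.

For the statement on rough paths, `H_N` is finite-dimensional, hence has a basis (`dualVec`) dual to
the basis of the products `b₁ ⋆ ⋯ ⋆ bₙ`; this basis is bihomogeneous since `Ψ` preserves the
gradings. As trees are primitive for the coproduct dual to the forest product, that product
corresponds to the shuffle product (`apply_dualVec_mul`). Hence `x ∈ T_N(B)` is a character for the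
shuffle product if and only if `Ψ⁻¹ x` is multiplicative for the forest product, and the latter
property is preserved by precomposition with the algebra morphism `M`. Chen's relation says
`X_{sr} X_{rt} = X_{st}` for the concatenation product, so it is preserved by multiplicative maps.
The analytic bounds are preserved since `M` does not decrease exponents: a word `u` contributes to
the coefficient of `w` in the image only if its exponent is at least that of `w`
(`IsRenormalisation.exponent_le`), and `|t - s| ≤ 1`.
-/

noncomputable section

namespace BranchedRP

variable {d : ℕ}

/-! ### Coassociativity and counit of the Butcher–Connes–Kreimer coproduct -/

theorem monomial_eq_prod_tree (f : Forest d) :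
    (MvPolynomial.monomial f 1 : H d) = ((Finsupp.toMultiset f).map tree).prod := by
  rw [MvPolynomial.monomial_eq, Finsupp.toMultiset_map, Finsupp.prod_toMultiset,
    Finsupp.prod_mapDomain_index (by simp) (by simp [pow_add])]
  simp [tree]

theorem Bplus_monomial (i : Fin (d + 1)) (f : Forest d) :
    Bplus i (MvPolynomial.monomial f 1) = tree (.node i (Finsupp.toMultiset f)) := by
  have h := (MvPolynomial.basisMonomials (DTree d) ℝ).constr_basis ℝ
    (fun f => tree (.node i (Finsupp.toMultiset f))) f
  simpa [Bplus] using h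

theorem Bplus_prod_tree (i : Fin (d + 1)) (m : Multiset (DTree d)) :
    Bplus i (m.map tree).prod = tree (.node i m) := by
  classical
  have h := Bplus_monomial i (Multiset.toFinsupp m)
  rwa [monomial_eq_prod_tree, Multiset.toFinsupp_toMultiset] at h

/-- The grafting operators `B₊ⁱ` are cocycles for the coproduct. -/
theorem coproduct_Bplus (i : Fin (d + 1)) (x : H d) :
    coproduct d (Bplus i x) = 1 ⊗ₜ[ℝ] Bplus i x + (Bplus i).rTensor (H d) (coproduct d x) := by
  have h : (coproduct d).toLinearMap ∘ₗ Bplus i = TensorProduct.mk ℝ (H d) (H d) 1 ∘ₗ Bplus i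
      + (Bplus i).rTensor (H d) ∘ₗ (coproduct d).toLinearMap := by
    refine (MvPolynomial.basisMonomials (DTree d) ℝ).ext fun f => ?_
    simp only [MvPolynomial.coe_basisMonomials, LinearMap.comp_apply, LinearMap.add_apply,
      AlgHom.toLinearMap_apply, TensorProduct.mk_apply]
    rw [Bplus_monomial, coproduct_node, ← monomial_eq_prod_tree]
  exact LinearMap.congr_fun h x

/-- Two algebra morphisms on `H` agree if, whenever they agree on the trees of a forest, they agree
on the trees obtained by grafting this forest. -/
theorem algHom_ext_Bplus {S : Type*} [CommSemiring S] [Algebra ℝ S] {φ ψ : H d →ₐ[ℝ] S}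
    (h : ∀ (i : Fin (d + 1)) (x : H d), φ x = ψ x → φ (Bplus i x) = ψ (Bplus i x)) : φ = ψ := by
  refine MvPolynomial.algHom_ext fun τ => ?_
  change φ (tree τ) = ψ (tree τ)
  induction τ using DTree.induction with
  | h i m ih =>
    rw [← Bplus_prod_tree]
    apply h
    rw [map_multiset_prod φ, map_multiset_prod ψ, Multiset.map_map, Multiset.map_map]
    exact congrArg _ (Multiset.map_congr rfl ih)

theorem coproduct_coassoc (x : H d) :
    TensorProduct.assoc ℝ (H d) (H d) (H d)
      ((coproduct d).toLinearMap.rTensor (H d) (coproduct d x)) =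
    (coproduct d).toLinearMap.lTensor (H d) (coproduct d x) := by
  have h : ((Algebra.TensorProduct.assoc ℝ ℝ ℝ (H d) (H d) (H d)).toAlgHom.comp
      (Algebra.TensorProduct.map (coproduct d) (AlgHom.id ℝ (H d)))).comp (coproduct d) =
      (Algebra.TensorProduct.map (AlgHom.id ℝ (H d)) (coproduct d)).comp (coproduct d) := by
    refine algHom_ext_Bplus (S := H d ⊗[ℝ] (H d ⊗[ℝ] H d))
      fun i x hx => ?_
    have hx' : TensorProduct.assoc ℝ (H d) (H d) (H d)
        ((coproduct d).toLinearMap.rTensor (H d) (coproduct d x)) =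
        (coproduct d).toLinearMap.lTensor (H d) (coproduct d x) := hx
    change TensorProduct.assoc ℝ (H d) (H d) (H d)
        ((coproduct d).toLinearMap.rTensor (H d) (coproduct d (Bplus i x))) =
        (coproduct d).toLinearMap.lTensor (H d) (coproduct d (Bplus i x))
    have h₁ : ∀ z : H d ⊗[ℝ] H d, TensorProduct.assoc ℝ (H d) (H d) (H d)
        ((coproduct d).toLinearMap.rTensor (H d) ((Bplus i).rTensor (H d) z)) =
        1 ⊗ₜ[ℝ] (Bplus i).rTensor (H d) z + (Bplus i).rTensor (H d ⊗[ℝ] H d)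
          (TensorProduct.assoc ℝ (H d) (H d) (H d)
            ((coproduct d).toLinearMap.rTensor (H d) z)) := by
      intro z
      induction z with
      | zero => simp
      | add z w hz hw =>
        simp only [map_add, hz, hw, TensorProduct.tmul_add]
        abel
      | tmul a b =>
        simp only [LinearMap.rTensor_tmul, AlgHom.toLinearMap_apply, coproduct_Bplus,
          TensorProduct.add_tmul, map_add, TensorProduct.assoc_tmul]
        congr 1
        induction coproduct d a with
        | zero => simp
        | add z w hz hw => simp only [map_add, hz, hw, TensorProduct.add_tmul]
        | tmul a' b' => simp
    have h₂ : ∀ z : H d ⊗[ℝ] H d, (coproduct d).toLinearMap.lTensor (H d)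
        ((Bplus i).rTensor (H d) z) = (Bplus i).rTensor (H d ⊗[ℝ] H d)
          ((coproduct d).toLinearMap.lTensor (H d) z) := by
      intro z
      induction z with
      | zero => simp
      | add z w hz hw => simp only [map_add, hz, hw]
      | tmul a b => simp
    rw [coproduct_Bplus, map_add, map_add, map_add, h₁, h₂, hx', LinearMap.rTensor_tmul,
      LinearMap.lTensor_tmul, AlgHom.toLinearMap_apply, AlgHom.toLinearMap_apply, map_one,
      coproduct_Bplus, TensorProduct.tmul_add, Algebra.TensorProduct.one_def,
      TensorProduct.assoc_tmul, add_assoc]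
  exact DFunLike.congr_fun h x

/-- The counit of `H`, as a morphism of algebras: the coefficient of the empty forest. -/
def counitHom (d : ℕ) : H d →ₐ[ℝ] ℝ := MvPolynomial.aeval fun _ => 0

theorem counitHom_apply (x : H d) : counitHom d x = MvPolynomial.coeff 0 x := by
  simp [counitHom, MvPolynomial.aeval_zero', MvPolynomial.constantCoeff_eq]

theorem counitHom_tree (τ : DTree d) : counitHom d (tree τ) = 0 := by
  simp [counitHom, tree]

theorem counitHom_Bplus (i : Fin (d + 1)) (x : H d) : counitHom d (Bplus i x) = 0 := by
  have h : (counitHom d).toLinearMap ∘ₗ Bplus i = 0 := by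
    refine (MvPolynomial.basisMonomials (DTree d) ℝ).ext fun f => ?_
    simp only [MvPolynomial.coe_basisMonomials, LinearMap.comp_apply, AlgHom.toLinearMap_apply,
      Bplus_monomial, counitHom_tree, LinearMap.zero_apply]
  exact LinearMap.congr_fun h x

theorem counit_coproduct (x : H d) :
    TensorProduct.lid ℝ (H d) ((counitHom d).toLinearMap.rTensor (H d) (coproduct d x)) = x := by
  have h : ((Algebra.TensorProduct.lid ℝ (H d)).toAlgHom.comp
      (Algebra.TensorProduct.map (counitHom d) (AlgHom.id ℝ (H d)))).comp (coproduct d) =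
      AlgHom.id ℝ (H d) := by
    refine algHom_ext_Bplus fun i x _ => ?_
    change TensorProduct.lid ℝ (H d)
      ((counitHom d).toLinearMap.rTensor (H d) (coproduct d (Bplus i x))) = Bplus i x
    have h₁ : (counitHom d).toLinearMap ∘ₗ Bplus i = 0 := by
      refine LinearMap.ext fun y => ?_
      exact counitHom_Bplus i y
    rw [coproduct_Bplus, map_add, ← LinearMap.comp_apply, ← LinearMap.rTensor_comp, h₁]
    simp
  exact DFunLike.congr_fun h x

theorem coproduct_counit (x : H d) :
    TensorProduct.rid ℝ (H d) ((counitHom d).toLinearMap.lTensor (H d) (coproduct d x)) = x := by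
  have h : ((Algebra.TensorProduct.rid ℝ ℝ (H d)).toAlgHom.comp
      (Algebra.TensorProduct.map (AlgHom.id ℝ (H d)) (counitHom d))).comp (coproduct d) =
      AlgHom.id ℝ (H d) := by
    refine algHom_ext_Bplus (S := H d) fun i x hx => ?_
    have hx' : TensorProduct.rid ℝ (H d)
      ((counitHom d).toLinearMap.lTensor (H d) (coproduct d x)) = x := hx
    change TensorProduct.rid ℝ (H d)
      ((counitHom d).toLinearMap.lTensor (H d) (coproduct d (Bplus i x))) = Bplus i x
    have h₁ : ∀ z : H d ⊗[ℝ] H d, TensorProduct.rid ℝ (H d)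
        ((counitHom d).toLinearMap.lTensor (H d) ((Bplus i).rTensor (H d) z)) =
        Bplus i (TensorProduct.rid ℝ (H d) ((counitHom d).toLinearMap.lTensor (H d) z)) := by
      intro z
      induction z with
      | zero => simp
      | add z w hz hw => simp only [map_add, hz, hw]
      | tmul a b => simp
    rw [coproduct_Bplus, map_add, map_add, h₁, hx']
    simp [counitHom_Bplus]
  exact DFunLike.congr_fun h x

/-! ### The convolution algebra of functionals on `H` -/

/-- The convolution product `(X ⊗ Y) Δ` of functionals on the whole of `H`. -/
def convolve (X Y : Module.Dual ℝ (H d)) : Module.Dual ℝ (H d) :=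
  LinearMap.mul' ℝ ℝ ∘ₗ TensorProduct.map X Y ∘ₗ (coproduct d).toLinearMap

theorem convolve_apply (X Y : Module.Dual ℝ (H d)) (x : H d) :
    convolve X Y x = LinearMap.mul' ℝ ℝ (TensorProduct.map X Y (coproduct d x)) := rfl

theorem convolve_assoc (X Y Z : Module.Dual ℝ (H d)) :
    convolve (convolve X Y) Z = convolve X (convolve Y Z) := by
  have h₁ : ∀ z : H d ⊗[ℝ] H d, LinearMap.mul' ℝ ℝ (TensorProduct.map (convolve X Y) Z z) =
      LinearMap.mul' ℝ ℝ (TensorProduct.map X (LinearMap.mul' ℝ ℝ ∘ₗ TensorProduct.map Y Z)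
        (TensorProduct.assoc ℝ (H d) (H d) (H d)
          ((coproduct d).toLinearMap.rTensor (H d) z))) := by
    intro z
    induction z with
    | zero => simp
    | add z w hz hw => simp only [map_add, hz, hw]
    | tmul a b =>
      simp only [TensorProduct.map_tmul, LinearMap.rTensor_tmul, convolve_apply,
        LinearMap.mul'_apply, AlgHom.toLinearMap_apply]
      induction coproduct d a with
      | zero => simp
      | add z w hz hw => simp only [map_add, TensorProduct.add_tmul, add_mul, hz, hw]
      | tmul a' b' => simp [mul_assoc]
  have h₂ : ∀ z : H d ⊗[ℝ] H d, LinearMap.mul' ℝ ℝ (TensorProduct.map X (convolve Y Z) z) =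
      LinearMap.mul' ℝ ℝ (TensorProduct.map X (LinearMap.mul' ℝ ℝ ∘ₗ TensorProduct.map Y Z)
        ((coproduct d).toLinearMap.lTensor (H d) z)) := by
    intro z
    induction z with
    | zero => simp
    | add z w hz hw => simp only [map_add, hz, hw]
    | tmul a b => simp [convolve_apply]
  refine LinearMap.ext fun x => ?_
  rw [convolve_apply, convolve_apply, h₁, h₂, coproduct_coassoc]

theorem counit_convolve (X : Module.Dual ℝ (H d)) :
    convolve (counitHom d).toLinearMap X = X := by
  have h : ∀ z : H d ⊗[ℝ] H d,
      LinearMap.mul' ℝ ℝ (TensorProduct.map (counitHom d).toLinearMap X z) =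
      X (TensorProduct.lid ℝ (H d) ((counitHom d).toLinearMap.rTensor (H d) z)) := by
    intro z
    induction z with
    | zero => simp
    | add z w hz hw => simp only [map_add, hz, hw]
    | tmul a b => simp
  refine LinearMap.ext fun x => ?_
  rw [convolve_apply, h, counit_coproduct]

theorem convolve_counit (X : Module.Dual ℝ (H d)) :
    convolve X (counitHom d).toLinearMap = X := by
  have h : ∀ z : H d ⊗[ℝ] H d,
      LinearMap.mul' ℝ ℝ (TensorProduct.map X (counitHom d).toLinearMap z) =
      X (TensorProduct.rid ℝ (H d) ((counitHom d).toLinearMap.lTensor (H d) z)) := by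
    intro z
    induction z with
    | zero => simp
    | add z w hz hw => simp only [map_add, hz, hw]
    | tmul a b => simp [mul_comm]
  refine LinearMap.ext fun x => ?_
  rw [convolve_apply, h, coproduct_counit]

/-- Precomposition with a morphism of bialgebras is multiplicative for the convolution. This applies
both to renormalisation maps and to the dilations which encode the grading. -/
theorem convolve_comp {φ : H d →ₐ[ℝ] H d}
    (hφ : (Algebra.TensorProduct.map φ φ).comp (coproduct d) = (coproduct d).comp φ)
    (X Y : Module.Dual ℝ (H d)) :
    convolve X Y ∘ₗ φ.toLinearMap = convolve (X ∘ₗ φ.toLinearMap) (Y ∘ₗ φ.toLinearMap) := by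
  refine LinearMap.ext fun x => ?_
  have h : coproduct d (φ x) = TensorProduct.map φ.toLinearMap φ.toLinearMap (coproduct d x) :=
    (DFunLike.congr_fun hφ x).symm
  rw [LinearMap.comp_apply, AlgHom.toLinearMap_apply, convolve_apply, h, convolve_apply,
    TensorProduct.map_comp, LinearMap.comp_apply]

theorem convolve_smul_smul (a b : ℝ) (X Y : Module.Dual ℝ (H d)) :
    convolve (a • X) (b • Y) = (a * b) • convolve X Y := by
  refine LinearMap.ext fun x => ?_
  simp only [convolve_apply, TensorProduct.map_smul_left, TensorProduct.map_smul_right,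
    LinearMap.smul_apply, map_smul, smul_smul, mul_comm]

/-! ### Dilations and the bigrading -/

/-- The number of nodes of a forest with decoration `0`. -/
def forestZeros (f : Forest d) : ℕ := f.sum fun τ n => n * τ.zeros

theorem forestSize_add (f g : Forest d) : forestSize (f + g) = forestSize f + forestSize g :=
  Finsupp.sum_add_index' (by simp) (by simp [add_mul])

theorem forestZeros_add (f g : Forest d) : forestZeros (f + g) = forestZeros f + forestZeros g :=
  Finsupp.sum_add_index' (by simp) (by simp [add_mul])

theorem forestSize_zero : forestSize (0 : Forest d) = 0 := Finsupp.sum_zero_index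

theorem forestZeros_zero : forestZeros (0 : Forest d) = 0 := Finsupp.sum_zero_index

theorem forestSize_single (τ : DTree d) (n : ℕ) : forestSize (Finsupp.single τ n) = n * τ.size :=
  Finsupp.sum_single_index (by simp)

theorem forestZeros_single (τ : DTree d) (n : ℕ) :
    forestZeros (Finsupp.single τ n) = n * τ.zeros :=
  Finsupp.sum_single_index (by simp)

theorem sum_map_toMultiset (g : DTree d → ℕ) (f : Forest d) :
    ((Finsupp.toMultiset f).map g).sum = f.sum fun τ n => n * g τ := by
  induction f using Finsupp.induction_linear with
  | zero => simp
  | add f f' hf hf' =>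
    rw [Finsupp.toMultiset_add, Multiset.map_add, Multiset.sum_add, hf, hf',
      Finsupp.sum_add_index' (by simp) (by simp [add_mul])]
  | single τ n => simp [Multiset.map_nsmul, Multiset.sum_nsmul]

theorem size_node_toMultiset (i : Fin (d + 1)) (f : Forest d) :
    (DTree.node i (Finsupp.toMultiset f)).size = 1 + forestSize f := by
  rw [DTree.size_node, sum_map_toMultiset, forestSize]

theorem zeros_node_toMultiset (i : Fin (d + 1)) (f : Forest d) :
    (DTree.node i (Finsupp.toMultiset f)).zeros = (if i = 0 then 1 else 0) + forestZeros f := by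
  rw [DTree.zeros_node, sum_map_toMultiset, forestZeros]

/-- The dilation which multiplies a tree `τ` by `a ^ |τ| * b ^ |τ|₀`. Homogeneity in the two
gradings is expressed as being an eigenvector of all dilations. -/
def dilation (a b : ℝ) : H d →ₐ[ℝ] H d :=
  MvPolynomial.aeval fun τ => (a ^ τ.size * b ^ τ.zeros) • tree τ

theorem dilation_tree (a b : ℝ) (τ : DTree d) :
    dilation a b (tree τ) = (a ^ τ.size * b ^ τ.zeros) • tree τ := by
  simp [dilation, tree]

theorem dilation_monomial (a b : ℝ) (f : Forest d) :
    dilation a b (MvPolynomial.monomial f 1) =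
      (a ^ forestSize f * b ^ forestZeros f) • MvPolynomial.monomial f 1 := by
  induction f using Finsupp.induction_linear with
  | zero => simp [forestSize_zero, forestZeros_zero]
  | add f g hf hg =>
    have h : (MvPolynomial.monomial (f + g) 1 : H d) =
        MvPolynomial.monomial f 1 * MvPolynomial.monomial g 1 := by simp
    rw [h, map_mul, hf, hg, smul_mul_smul_comm, forestSize_add, forestZeros_add, pow_add, pow_add]
    congr 1
    ring
  | single τ n =>
    have h : (MvPolynomial.monomial (Finsupp.single τ n) 1 : H d) = tree τ ^ n := by
      rw [tree, MvPolynomial.X_pow_eq_monomial]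
    rw [h, map_pow, dilation_tree, smul_pow, forestSize_single, forestZeros_single, mul_pow,
      ← pow_mul, ← pow_mul, mul_comm n, mul_comm n]

theorem dilation_Bplus (a b : ℝ) (i : Fin (d + 1)) (x : H d) :
    dilation a b (Bplus i x) = (a * b ^ (if i = 0 then 1 else 0)) • Bplus i (dilation a b x) := by
  have h : (dilation a b).toLinearMap ∘ₗ Bplus i =
      (a * b ^ (if i = 0 then 1 else 0)) • (Bplus i ∘ₗ (dilation a b).toLinearMap) := by
    refine (MvPolynomial.basisMonomials (DTree d) ℝ).ext fun f => ?_
    simp only [MvPolynomial.coe_basisMonomials, LinearMap.comp_apply, LinearMap.smul_apply,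
      AlgHom.toLinearMap_apply]
    rw [Bplus_monomial, dilation_tree, dilation_monomial, map_smul, Bplus_monomial, smul_smul,
      size_node_toMultiset, zeros_node_toMultiset, pow_add, pow_add, pow_one]
    congr 1
    ring
  exact LinearMap.congr_fun h x

/-- The coproduct preserves both gradings, since dilations are morphisms of bialgebras. -/
theorem dilation_cointeraction (a b : ℝ) :
    (Algebra.TensorProduct.map (dilation a b) (dilation a b)).comp (coproduct d) =
      (coproduct d).comp (dilation a b) := by
  refine algHom_ext_Bplus (S := H d ⊗[ℝ] H d) fun i x hx => ?_
  have hx' : Algebra.TensorProduct.map (dilation a b) (dilation a b) (coproduct d x) =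
    coproduct d (dilation a b x) := hx
  change Algebra.TensorProduct.map (dilation a b) (dilation a b) (coproduct d (Bplus i x)) =
    coproduct d (dilation a b (Bplus i x))
  have h : ∀ z : H d ⊗[ℝ] H d, Algebra.TensorProduct.map (dilation a b) (dilation a b)
      ((Bplus i).rTensor (H d) z) = (a * b ^ (if i = 0 then 1 else 0)) • (Bplus i).rTensor (H d)
        (Algebra.TensorProduct.map (dilation a b) (dilation a b) z) := by
    intro z
    induction z with
    | zero => simp
    | add z w hz hw => simp only [map_add, hz, hw, smul_add]
    | tmul x y =>
      rw [LinearMap.rTensor_tmul, Algebra.TensorProduct.map_tmul, Algebra.TensorProduct.map_tmul,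
        LinearMap.rTensor_tmul, dilation_Bplus, TensorProduct.smul_tmul']
  rw [coproduct_Bplus, map_add, h, hx', dilation_Bplus, map_smul, coproduct_Bplus, smul_add,
    Algebra.TensorProduct.map_tmul, map_one, dilation_Bplus, TensorProduct.tmul_smul]

theorem degree_eq_of_pow_eq {m k n z : ℕ} (h : ∀ a b : ℝ, a ^ m * b ^ k = a ^ n * b ^ z) :
    m = n ∧ k = z := by
  have h₁ := h 2 1
  have h₂ := h 1 2
  simp only [one_pow, mul_one, one_mul] at h₁ h₂
  exact ⟨pow_right_injective₀ two_pos (by norm_num) h₁,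
    pow_right_injective₀ two_pos (by norm_num) h₂⟩

/-- A functional on `H` is bihomogeneous if it vanishes on all forests except those with `n` nodes,
`z` of which are decorated by `0`, see `IsBihomogeneous.degree_eq`. -/
def IsBihomogeneous (X : Module.Dual ℝ (H d)) (n z : ℕ) : Prop :=
  ∀ a b : ℝ, X ∘ₗ (dilation a b).toLinearMap = (a ^ n * b ^ z) • X

namespace IsBihomogeneous

variable {X Y : Module.Dual ℝ (H d)} {n z n' z' : ℕ}

theorem degree_eq (hX : IsBihomogeneous X n z) {f : Forest d}
    (hf : X (MvPolynomial.monomial f 1) ≠ 0) : forestSize f = n ∧ forestZeros f = z := by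
  have h : ∀ a b : ℝ, a ^ forestSize f * b ^ forestZeros f = a ^ n * b ^ z := fun a b => by
    have h := LinearMap.congr_fun (hX a b) (MvPolynomial.monomial f 1)
    rw [LinearMap.comp_apply, AlgHom.toLinearMap_apply, dilation_monomial, map_smul,
      LinearMap.smul_apply] at h
    exact mul_right_cancel₀ hf h
  exact degree_eq_of_pow_eq h

theorem convolve (hX : IsBihomogeneous X n z) (hY : IsBihomogeneous Y n' z') :
    IsBihomogeneous (convolve X Y) (n + n') (z + z') := by
  intro a b
  rw [convolve_comp (dilation_cointeraction a b), hX, hY, convolve_smul_smul, pow_add, pow_add]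
  congr 1
  ring

theorem smul (hX : IsBihomogeneous X n z) (c : ℝ) : IsBihomogeneous (c • X) n z := by
  intro a b
  rw [LinearMap.smul_comp, hX, smul_comm]

theorem sum {ι : Type*} {s : Finset ι} {X : ι → Module.Dual ℝ (H d)}
    (hX : ∀ i ∈ s, IsBihomogeneous (X i) n z) : IsBihomogeneous (∑ i ∈ s, X i) n z := by
  intro a b
  refine LinearMap.ext fun x => ?_
  rw [LinearMap.comp_apply, LinearMap.sum_apply, LinearMap.smul_apply, LinearMap.sum_apply,
    Finset.smul_sum]
  exact Finset.sum_congr rfl fun i hi => LinearMap.congr_fun (hX i hi a b) x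

theorem lcoeff (f : Forest d) :
    IsBihomogeneous (MvPolynomial.lcoeff ℝ f) (forestSize f) (forestZeros f) := by
  classical
  intro a b
  refine (MvPolynomial.basisMonomials (DTree d) ℝ).ext fun g => ?_
  simp only [MvPolynomial.coe_basisMonomials, LinearMap.comp_apply, LinearMap.smul_apply,
    AlgHom.toLinearMap_apply, dilation_monomial, map_smul, MvPolynomial.lcoeff_apply,
    MvPolynomial.coeff_monomial]
  split_ifs with h
  · rw [h]
  · simp

end IsBihomogeneous

theorem isBihomogeneous_counit : IsBihomogeneous (counitHom d).toLinearMap 0 0 := by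
  have h : (counitHom d).toLinearMap = MvPolynomial.lcoeff ℝ (0 : Forest d) :=
    LinearMap.ext counitHom_apply
  have h' := IsBihomogeneous.lcoeff (0 : Forest d)
  rwa [forestSize_zero, forestZeros_zero, ← h] at h'

/-! ### Truncation -/

variable {N : ℕ}

theorem monomial_mem_HN {f : Forest d} {n : ℕ} (hf : forestSize f ≤ n) :
    MvPolynomial.monomial f 1 ∈ HN d n :=
  Submodule.subset_span ⟨f, hf, rfl⟩

theorem mul_mem_HN {m n : ℕ} {x y : H d} (hx : x ∈ HN d m) (hy : y ∈ HN d n) :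
    x * y ∈ HN d (m + n) := by
  refine (Submodule.mul_le.1 ?_) x hx y hy
  rw [HN, HN, Submodule.span_mul_span]
  refine Submodule.span_le.2 ?_
  rintro _ ⟨_, ⟨f, hf, rfl⟩, _, ⟨g, hg, rfl⟩, rfl⟩
  have h : forestSize (f + g) ≤ m + n := by
    rw [forestSize_add]
    exact add_le_add hf hg
  simpa using monomial_mem_HN h

theorem HN_mono {m n : ℕ} (h : m ≤ n) : HN d m ≤ HN d n :=
  Submodule.span_mono fun _ ⟨f, hf, hx⟩ => ⟨f, hf.trans h, hx⟩

theorem mem_HN_iff {n : ℕ} {x : H d} :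
    x ∈ HN d n ↔ ∀ f, MvPolynomial.coeff f x ≠ 0 → forestSize f ≤ n := by
  classical
  constructor
  · intro hx
    induction hx using Submodule.span_induction with
    | mem x hx =>
      obtain ⟨g, hg, rfl⟩ := hx
      intro f hf
      rw [MvPolynomial.coeff_monomial] at hf
      by_cases h : g = f
      · exact h ▸ hg
      · simp [h] at hf
    | zero => simp
    | add x y _ _ hx hy =>
      intro f hf
      by_contra h
      exact hf (by
        rw [MvPolynomial.coeff_add, not_not.1 (mt (hx f) h), not_not.1 (mt (hy f) h), add_zero])
    | smul a x _ hx =>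
      intro f hf
      refine hx f fun h => hf ?_
      rw [MvPolynomial.coeff_smul, h, smul_zero]
  · intro h
    rw [MvPolynomial.as_sum x]
    refine Submodule.sum_mem _ fun f hf => ?_
    have hm := Submodule.smul_mem _ (MvPolynomial.coeff f x)
      (monomial_mem_HN (h f (MvPolynomial.mem_support_iff.1 hf)))
    simpa [MvPolynomial.smul_monomial] using hm

theorem proj_monomial {f : Forest d} (hf : forestSize f ≤ N) :
    proj d N (MvPolynomial.monomial f 1) = ⟨MvPolynomial.monomial f 1, monomial_mem_HN hf⟩ := by
  classical
  have h := (MvPolynomial.basisMonomials (DTree d) ℝ).constr_basis ℝ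
    (fun f : Forest d => if h : forestSize f ≤ N then
      (⟨MvPolynomial.monomial f 1, monomial_mem_HN h⟩ : HN d N) else 0) f
  rw [dif_pos hf, MvPolynomial.coe_basisMonomials] at h
  rw [← h, proj]

theorem proj_of_mem {x : H d} (hx : x ∈ HN d N) : proj d N x = ⟨x, hx⟩ := by
  have h : proj d N ∘ₗ (HN d N).subtype = LinearMap.id := by
    refine LinearMap.ext_on_range
      (v := fun f : {f : Forest d // forestSize f ≤ N} =>
        (⟨MvPolynomial.monomial f.1 1, monomial_mem_HN f.2⟩ : HN d N)) ?_ ?_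
    · rw [Submodule.span_range_subtype_eq_top_iff]
      · apply congrArg
        ext x
        constructor
        · rintro ⟨f, rfl⟩
          exact ⟨f.1, f.2, rfl⟩
        · rintro ⟨f, hf, rfl⟩
          exact ⟨⟨f, hf⟩, rfl⟩
    · intro f
      exact proj_monomial f.2
  exact LinearMap.congr_fun h ⟨x, hx⟩

/-- The restriction of functionals from `H` to `H_N`. -/
def restrict (N : ℕ) : Module.Dual ℝ (H d) →ₗ[ℝ] HNdual d N := (HN d N).subtype.dualMap

theorem restrict_apply (X : Module.Dual ℝ (H d)) (x : HN d N) : restrict N X x = X x := rfl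

theorem restrict_proj (X : HNdual d N) : restrict N (X ∘ₗ proj d N) = X := by
  refine LinearMap.ext fun x => ?_
  rw [restrict_apply, LinearMap.comp_apply, proj_of_mem x.2]

theorem restrict_ext {X Y : Module.Dual ℝ (H d)}
    (h : ∀ f, forestSize f ≤ N →
      X (MvPolynomial.monomial f 1) = Y (MvPolynomial.monomial f 1)) :
    restrict N X = restrict N Y := by
  have h' : HN d N ≤ LinearMap.eqLocus X Y := by
    refine Submodule.span_le.2 ?_
    rintro _ ⟨f, hf, rfl⟩
    exact h f hf
  exact LinearMap.ext fun x => h' x.2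

theorem tensor_repr_eq (z : H d ⊗[ℝ] H d) (p : Forest d × Forest d) :
    ((MvPolynomial.basisMonomials (DTree d) ℝ).tensorProduct
      (MvPolynomial.basisMonomials (DTree d) ℝ)).repr z p =
    LinearMap.mul' ℝ ℝ
      (TensorProduct.map (MvPolynomial.lcoeff ℝ p.1) (MvPolynomial.lcoeff ℝ p.2) z) := by
  induction z with
  | zero => simp
  | add z w hz hw => simp only [map_add, Finsupp.add_apply, hz, hw]
  | tmul x y =>
    rw [Module.Basis.tensorProduct_repr_tmul_apply, TensorProduct.map_tmul, LinearMap.mul'_apply,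
      smul_eq_mul, mul_comm]
    rfl

/-- The restriction to `H_N` is multiplicative, since every term of the coproduct of a forest has as
many nodes as the forest. -/
theorem restrict_convolve (X Y : Module.Dual ℝ (H d)) :
    restrict N (convolve X Y) = conv (restrict N X) (restrict N Y) := by
  change restrict N (convolve X Y) =
    restrict N (convolve (restrict N X ∘ₗ proj d N) (restrict N Y ∘ₗ proj d N))
  refine restrict_ext fun f hf => ?_
  let b := (MvPolynomial.basisMonomials (DTree d) ℝ)
  rw [convolve_apply, convolve_apply, ← (b.tensorProduct b).linearCombination_repr
    (coproduct d (MvPolynomial.monomial f 1)), Finsupp.linearCombination_apply, Finsupp.sum]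
  simp only [map_sum, map_smul]
  refine Finset.sum_congr rfl fun p hp => ?_
  rw [Finsupp.mem_support_iff, tensor_repr_eq, ← convolve_apply] at hp
  have h := (((IsBihomogeneous.lcoeff p.1).convolve (IsBihomogeneous.lcoeff p.2)).degree_eq hp).1
  have hb : (b.tensorProduct b) p =
      MvPolynomial.monomial p.1 1 ⊗ₜ[ℝ] MvPolynomial.monomial p.2 1 := by
    rw [Module.Basis.tensorProduct_apply']
    simp [b]
  rw [hb, TensorProduct.map_tmul, TensorProduct.map_tmul, LinearMap.comp_apply,
    LinearMap.comp_apply, proj_monomial (by omega), proj_monomial (by omega)]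
  rfl

/-! ### Functionals associated with words -/

/-- A linear combination of trees as a functional on `H`. -/
def letter : (DTree d →₀ ℝ) →ₗ[ℝ] Module.Dual ℝ (H d) :=
  Finsupp.linearCombination ℝ fun τ => MvPolynomial.lcoeff ℝ (Finsupp.single τ 1)

theorem restrict_letter (N : ℕ) (b : DTree d →₀ ℝ) : restrict N (letter b) = toDual N b := by
  rw [letter, toDual, Finsupp.apply_linearCombination]
  rfl

theorem isBihomogeneous_letter {b : DTree d →₀ ℝ} (hb : IsHomogeneous b) :
    IsBihomogeneous (letter b) (deg b) (zdeg b) := by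
  rw [letter, Finsupp.linearCombination_apply, Finsupp.sum]
  refine IsBihomogeneous.sum fun τ hτ => IsBihomogeneous.smul ?_ _
  obtain ⟨h₁, h₂⟩ := hb τ hτ
  have h := IsBihomogeneous.lcoeff (Finsupp.single τ 1)
  rwa [forestSize_single, forestZeros_single, one_mul, one_mul, h₁, h₂] at h

/-- Linear combinations of trees are primitive for the coproduct dual to the forest product. -/
theorem letter_mul (b : DTree d →₀ ℝ) (x y : H d) :
    letter b (x * y) = letter b x * counitHom d y + counitHom d x * letter b y := by
  classical
  rw [letter, Finsupp.linearCombination_apply, Finsupp.sum]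
  simp only [LinearMap.sum_apply, LinearMap.smul_apply, Finset.sum_mul, Finset.mul_sum,
    ← Finset.sum_add_distrib]
  refine Finset.sum_congr rfl fun τ _ => ?_
  rw [MvPolynomial.lcoeff_apply, MvPolynomial.coeff_mul, Finsupp.antidiagonal_single]
  simp only [Finset.Nat.antidiagonal_succ, Finset.Nat.antidiagonal_zero, MvPolynomial.lcoeff_apply,
    counitHom_apply, smul_eq_mul]
  simp
  ring

variable {B : Set (DTree d →₀ ℝ)}

/-- The product `b₁ ⋆ ⋯ ⋆ bₙ`, as a functional on the whole of `H`. -/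
def starFull (w : List B) : Module.Dual ℝ (H d) :=
  (w.map fun b => letter b.1).foldr convolve (counitHom d).toLinearMap

theorem starFull_nil : starFull ([] : List B) = (counitHom d).toLinearMap := rfl

theorem starFull_cons (b : B) (w : List B) :
    starFull (b :: w) = convolve (letter b.1) (starFull w) := rfl

theorem starFull_append (u v : List B) :
    starFull (u ++ v) = convolve (starFull u) (starFull v) := by
  induction u with
  | nil => rw [List.nil_append, starFull_nil, counit_convolve]
  | cons b u ih => rw [List.cons_append, starFull_cons, starFull_cons, ih, convolve_assoc]

theorem starFull_singleton (b : B) : starFull [b] = letter b.1 := by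
  rw [starFull_cons, starFull_nil, convolve_counit]

theorem restrict_starFull (w : Word B N) : restrict N (starFull w.1) = starWord w := by
  obtain ⟨w, hw⟩ := w
  change restrict N (starFull w) = (w.map fun b => toDual N b.1).foldr conv (counit d N)
  clear hw
  induction w with
  | nil => exact LinearMap.ext fun x => counitHom_apply _
  | cons b w ih =>
    rw [starFull_cons, restrict_convolve, ih, restrict_letter]
    rfl

/-- The number of nodes of a word with decoration `0`. -/
def wordZeros (w : List B) : ℕ := (w.map fun b => zdeg b.1).sum

theorem wordSize_cons (b : B) (w : List B) : wordSize (b :: w) = deg b.1 + wordSize w := rfl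

theorem wordSize_append (u v : List B) : wordSize (u ++ v) = wordSize u + wordSize v := by
  simp [wordSize]

theorem wordExponent_eq (γ : ℝ) (w : List B) :
    wordExponent γ w = exponent γ (wordSize w) (wordZeros w) := by
  induction w with
  | nil => simp [wordExponent, exponent, wordSize, wordZeros]
  | cons b w ih =>
    simp only [wordExponent, exponent, wordSize, wordZeros, List.map_cons, List.sum_cons,
      Nat.cast_add] at ih ⊢
    rw [ih]
    ring

theorem isBihomogeneous_starFull (hB : ∀ b ∈ B, IsHomogeneous b) (w : List B) :
    IsBihomogeneous (starFull w) (wordSize w) (wordZeros w) := by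
  induction w with
  | nil => exact isBihomogeneous_counit
  | cons b w ih => exact (isBihomogeneous_letter (hB b.1 b.2)).convolve ih

theorem restrict_starFull_of_lt (hB : ∀ b ∈ B, IsHomogeneous b) {w : List B}
    (hw : N < wordSize w) : restrict N (starFull w) = 0 := by
  rw [← map_zero (restrict N)]
  refine restrict_ext fun f hf => ?_
  by_contra h
  have := ((isBihomogeneous_starFull hB w).degree_eq h).1
  omega

/-! ### Shuffles and the forest product -/

/-- The multiset of the pairs of complementary subwords of a word: the deshuffling coproduct, dual
to the shuffle product, see `count_shuffle`. -/
def splits {A : Type*} : List A → Multiset (List A × List A)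
  | [] => {([], [])}
  | a :: w => (splits w).map (Prod.map (List.cons a) id) + (splits w).map (Prod.map id (List.cons a))

theorem count_cons_map_cons {A : Type*} [DecidableEq A] (a b : A) (w : List A)
    (s : Multiset (List A)) :
    (s.map (List.cons b)).count (a :: w) = if a = b then s.count w else 0 := by
  split_ifs with h
  · subst h
    exact Multiset.count_map_eq_count' _ _ List.cons_injective _
  · refine Multiset.count_eq_zero.2 fun hm => ?_
    obtain ⟨_, _, h'⟩ := Multiset.mem_map.1 hm
    exact h (List.cons.inj h').1.symm

theorem count_map_cons_left {A : Type*} [DecidableEq A] (a : A) (u v : List A)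
    (s : Multiset (List A × List A)) :
    (s.map (Prod.map (List.cons a) id)).count (u, v) =
      match u with
      | [] => 0
      | b :: u => if a = b then s.count (u, v) else 0 := by
  cases u with
  | nil => exact Multiset.count_eq_zero.2 (by simp)
  | cons b u =>
    simp only
    split_ifs with h
    · subst h
      exact Multiset.count_map_eq_count' _ _
        (List.cons_injective.prodMap Function.injective_id) (u, v)
    · refine Multiset.count_eq_zero.2 fun hm => ?_
      obtain ⟨_, _, h'⟩ := Multiset.mem_map.1 hm
      exact h (List.cons.inj (Prod.mk.inj h').1).1

theorem count_map_cons_right {A : Type*} [DecidableEq A] (a : A) (u v : List A)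
    (s : Multiset (List A × List A)) :
    (s.map (Prod.map id (List.cons a))).count (u, v) =
      match v with
      | [] => 0
      | b :: v => if a = b then s.count (u, v) else 0 := by
  cases v with
  | nil => exact Multiset.count_eq_zero.2 (by simp)
  | cons b v =>
    simp only
    split_ifs with h
    · subst h
      exact Multiset.count_map_eq_count' _ _
        (Function.injective_id.prodMap List.cons_injective) (u, v)
    · refine Multiset.count_eq_zero.2 fun hm => ?_
      obtain ⟨_, _, h'⟩ := Multiset.mem_map.1 hm
      exact h (List.cons.inj (Prod.mk.inj h').2).1

theorem shuffle_nil_right {A : Type*} (u : List A) : shuffle u [] = {u} := by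
  cases u <;> simp [shuffle]

theorem count_shuffle {A : Type*} [DecidableEq A] (w u v : List A) :
    (shuffle u v).count w = (splits w).count (u, v) := by
  induction w generalizing u v with
  | nil =>
    cases u with
    | nil => simp [shuffle, splits, Multiset.count_singleton]
    | cons a u =>
      cases v with
      | nil => simp [shuffle, splits]
      | cons b v =>
        rw [shuffle, Multiset.count_eq_zero.2 (by simp), splits]
        simp
  | cons c w ih =>
    rw [splits, Multiset.count_add, count_map_cons_left, count_map_cons_right]
    cases u with
    | nil =>
      cases v with
      | nil => simp [shuffle]
      | cons b v => simp [← ih, shuffle, Multiset.count_singleton, ite_and]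
    | cons a u =>
      cases v with
      | nil => simp [← ih, shuffle_nil_right, Multiset.count_singleton, ite_and]
      | cons b v => simp [← ih, shuffle, count_cons_map_cons]

theorem convolve_primitive_mul {ι : Type*} {b X : Module.Dual ℝ (H d)}
    (hb : ∀ x y, b (x * y) = b x * counitHom d y + counitHom d x * b y) {s : Multiset ι}
    {F G : ι → Module.Dual ℝ (H d)}
    (hX : ∀ x y, X (x * y) = (s.map fun p => F p x * G p y).sum) (x y : H d) :
    convolve b X (x * y) =
      (s.map fun p => convolve b (F p) x * G p y + F p x * convolve b (G p) y).sum := by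
  let m (Y Z : Module.Dual ℝ (H d)) : H d ⊗[ℝ] H d →ₗ[ℝ] ℝ :=
    LinearMap.mul' ℝ ℝ ∘ₗ TensorProduct.map Y Z
  let e := (counitHom d).toLinearMap
  have key : ∀ z z' : H d ⊗[ℝ] H d, m b X (z * z') =
      (s.map fun p => m b (F p) z * m e (G p) z' + m e (F p) z * m b (G p) z').sum := by
    intro z z'
    induction z with
    | zero => simp
    | add z w hz hw =>
      rw [add_mul, map_add, hz, hw, ← Multiset.sum_map_add]
      refine congrArg _ (Multiset.map_congr rfl fun p _ => ?_)
      rw [map_add, map_add]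
      ring
    | tmul x₁ x₂ =>
      induction z' with
      | zero => simp
      | add z w hz hw =>
        rw [mul_add, map_add, hz, hw, ← Multiset.sum_map_add]
        refine congrArg _ (Multiset.map_congr rfl fun p _ => ?_)
        rw [map_add, map_add]
        ring
      | tmul y₁ y₂ =>
        have h : m b X (x₁ ⊗ₜ[ℝ] x₂ * y₁ ⊗ₜ[ℝ] y₂) = b (x₁ * y₁) * X (x₂ * y₂) := by
          simp [m, Algebra.TensorProduct.tmul_mul_tmul]
        rw [h, hb, hX, ← Multiset.sum_map_mul_left]
        refine congrArg _ (Multiset.map_congr rfl fun p _ => ?_)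
        simp only [m, e, LinearMap.comp_apply, TensorProduct.map_tmul, LinearMap.mul'_apply,
          AlgHom.toLinearMap_apply]
        ring
  have h := key (coproduct d x) (coproduct d y)
  rw [← map_mul] at h
  refine h.trans (congrArg _ (Multiset.map_congr rfl fun p _ => ?_))
  have h₁ := LinearMap.congr_fun (counit_convolve (F p)) x
  have h₂ := LinearMap.congr_fun (counit_convolve (G p)) y
  rw [convolve_apply] at h₁ h₂
  rw [← h₁, ← h₂]
  rfl

/-- The coproduct dual to the forest product is the deshuffling coproduct on products of letters,
because letters are primitive. -/
theorem starFull_mul (w : List B) (x y : H d) :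
    starFull w (x * y) = ((splits w).map fun p => starFull p.1 x * starFull p.2 y).sum := by
  induction w generalizing x y with
  | nil => simp [splits, starFull_nil]
  | cons b w ih =>
    rw [starFull_cons, convolve_primitive_mul (letter_mul b.1) ih, splits, Multiset.map_add,
      Multiset.sum_add, Multiset.map_map, Multiset.map_map, ← Multiset.sum_map_add]
    rfl

/-! ### Finiteness -/

theorem DTree.one_le_size (τ : DTree d) : 1 ≤ τ.size := by
  induction τ using DTree.induction with
  | h i m _ =>
    rw [DTree.size_node]
    omega

theorem finite_forests_of_trees {n : ℕ} (h : {τ : DTree d | τ.size ≤ n}.Finite) :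
    {f : Forest d | forestSize f ≤ n}.Finite := by
  classical
  refine (Set.finite_Iic (Finsupp.indicator h.toFinset fun _ _ => n)).subset fun f hf => ?_
  rw [Set.mem_Iic]
  intro τ
  rcases eq_or_ne (f τ) 0 with h0 | h0
  · rw [h0]
    exact Nat.zero_le _
  have h₁ : f τ * τ.size ≤ n :=
    (Finset.single_le_sum (f := fun τ => f τ * τ.size) (fun _ _ => Nat.zero_le _)
      (Finsupp.mem_support_iff.2 h0)).trans hf
  have h₂ := τ.one_le_size
  have h₃ : τ.size ≤ n := (Nat.le_mul_of_pos_left _ (Nat.pos_of_ne_zero h0)).trans h₁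
  rw [Finsupp.indicator_apply, dif_pos (by simpa using h₃)]
  exact (Nat.le_mul_of_pos_right _ h₂).trans h₁

theorem finite_trees (d n : ℕ) : {τ : DTree d | τ.size ≤ n}.Finite := by
  classical
  induction n with
  | zero =>
    refine Set.finite_empty.subset fun τ hτ => ?_
    have h₁ := τ.one_le_size
    have h₂ : τ.size ≤ 0 := hτ
    omega
  | succ n ih =>
    refine ((Set.finite_univ.prod (finite_forests_of_trees ih)).image
      fun p : Fin (d + 1) × Forest d => DTree.node p.1 (Finsupp.toMultiset p.2)).subset ?_
    intro τ
    induction τ using DTree.induction with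
    | h i m _ =>
      intro hτ
      have h := size_node_toMultiset i (Multiset.toFinsupp m)
      rw [Multiset.toFinsupp_toMultiset] at h
      have hτ' : (DTree.node i m).size ≤ n + 1 := hτ
      refine ⟨(i, Multiset.toFinsupp m), ⟨Set.mem_univ _, ?_⟩, ?_⟩
      · change forestSize (Multiset.toFinsupp m) ≤ n
        omega
      · simp only [Multiset.toFinsupp_toMultiset]

instance HN_finite (d N : ℕ) : Module.Finite ℝ (HN d N) := by
  refine Module.Finite.of_fg (Submodule.fg_span ?_)
  refine ((finite_forests_of_trees (finite_trees d N)).image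
    fun f => (MvPolynomial.monomial f 1 : H d)).subset ?_
  rintro _ ⟨f, hf, rfl⟩
  exact ⟨f, hf, rfl⟩

/-! ### Adjoints and the isomorphism `Ψ` -/

theorem adjoint_restrict {M : H d →ₐ[ℝ] H d} (hM : ∀ x ∈ HN d N, M x ∈ HN d N)
    (X : Module.Dual ℝ (H d)) :
    adjoint N M (restrict N X) = restrict N (X ∘ₗ M.toLinearMap) := by
  refine LinearMap.ext fun x => ?_
  change X (proj d N (M x)) = X (M x)
  rw [proj_of_mem (hM x x.2)]

/-- The adjoint of a morphism of bialgebras is multiplicative for `⋆`. -/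
theorem adjoint_conv {M : H d →ₐ[ℝ] H d} (hM : ∀ x ∈ HN d N, M x ∈ HN d N)
    (hc : (Algebra.TensorProduct.map M M).comp (coproduct d) = (coproduct d).comp M)
    (X Y : HNdual d N) : adjoint N M (conv X Y) = conv (adjoint N M X) (adjoint N M Y) := by
  rw [← restrict_proj X, ← restrict_proj Y, ← restrict_convolve, adjoint_restrict hM,
    adjoint_restrict hM, adjoint_restrict hM, convolve_comp hc, restrict_convolve]

theorem dilation_mem_HN (a b : ℝ) {x : H d} (hx : x ∈ HN d N) :
    dilation a b x ∈ HN d N := by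
  have h : HN d N ≤ (HN d N).comap (dilation a b).toLinearMap := by
    refine Submodule.span_le.2 ?_
    rintro _ ⟨f, hf, rfl⟩
    change dilation a b (MvPolynomial.monomial f 1) ∈ HN d N
    rw [dilation_monomial]
    exact Submodule.smul_mem _ _ (monomial_mem_HN hf)
  exact h hx

section

variable (hB : IsStarBasis B N)

theorem Psi_starWord (w : Word B N) : Psi hB (starWord w) = Finsupp.single w 1 := by
  have h := (Module.Basis.mk hB.linearIndependent hB.spans).repr_self w
  rwa [Module.Basis.coe_mk] at h

theorem Psi_symm_apply (X : TN B N) : (Psi hB).symm X = X.sum fun w a => a • starWord w := by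
  rw [Psi, Module.Basis.repr_symm_apply, Finsupp.linearCombination_apply, Module.Basis.coe_mk]

theorem Psi_restrict_starFull (w : List B) : Psi hB (restrict N (starFull w)) = TN.word N w := by
  rw [TN.word]
  split_ifs with h
  · rw [restrict_starFull ⟨w, h⟩, Psi_starWord]
  · rw [restrict_starFull_of_lt hB.homogeneous (by omega), map_zero]

/-- The basis of `H_N` dual to the basis of the products of letters. It exists as `H_N` has finite
dimension, hence is reflexive. -/
def dualVec (w : Word B N) : HN d N :=
  (Module.evalEquiv ℝ (HN d N)).symm ((Module.Basis.mk hB.linearIndependent hB.spans).coord w)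

theorem apply_dualVec (Y : HNdual d N) (w : Word B N) : Y (dualVec hB w) = Psi hB Y w := by
  rw [dualVec, Module.apply_evalEquiv_symm_apply]
  rfl

theorem starFull_dualVec [DecidableEq (List B)] (u : List B) (w : Word B N) :
    starFull u (dualVec hB w : H d) = if u = w.1 then 1 else 0 := by
  have h := apply_dualVec hB (restrict N (starFull u)) w
  rw [Psi_restrict_starFull, restrict_apply] at h
  rw [h, TN.word]
  split_ifs with h₁ h₂ h₂
  · rw [Finsupp.single_apply, if_pos (Subtype.ext h₂)]
  · rw [Finsupp.single_apply, if_neg fun h => h₂ (congrArg Subtype.val h)]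
  · exact absurd (h₂ ▸ w.2) h₁
  · rfl

theorem Psi_adjoint_dilation (a b : ℝ) (Y : HNdual d N) (w : Word B N) :
    Psi hB (adjoint N (dilation a b) Y) w =
      (a ^ wordSize w.1 * b ^ wordZeros w.1) * Psi hB Y w := by
  classical
  have h : Finsupp.lapply w ∘ₗ (Psi hB).toLinearMap ∘ₗ adjoint N (dilation a b) =
      (a ^ wordSize w.1 * b ^ wordZeros w.1) • (Finsupp.lapply w ∘ₗ (Psi hB).toLinearMap) := by
    refine (Module.Basis.mk hB.linearIndependent hB.spans).ext fun u => ?_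
    rw [Module.Basis.coe_mk]
    simp only [LinearMap.comp_apply, LinearMap.smul_apply, Finsupp.lapply_apply,
      LinearEquiv.coe_coe]
    rw [← restrict_starFull, adjoint_restrict fun x hx => dilation_mem_HN a b hx,
      isBihomogeneous_starFull hB.homogeneous, map_smul, map_smul, restrict_starFull,
      Psi_starWord, Finsupp.smul_apply, Finsupp.single_apply]
    split_ifs with h
    · rw [h]
    · simp
  exact LinearMap.congr_fun h Y

/-- `Ψ` preserves the two gradings. -/
theorem degree_eq_of_Psi_ne_zero {X : Module.Dual ℝ (H d)} {n z : ℕ} (hX : IsBihomogeneous X n z)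
    {w : Word B N} (hw : Psi hB (restrict N X) w ≠ 0) : wordSize w.1 = n ∧ wordZeros w.1 = z := by
  have h : ∀ a b : ℝ, a ^ wordSize w.1 * b ^ wordZeros w.1 = a ^ n * b ^ z := fun a b => by
    have h := Psi_adjoint_dilation hB a b (restrict N X) w
    rw [adjoint_restrict fun x hx => dilation_mem_HN a b hx, hX, map_smul, map_smul,
      Finsupp.smul_apply, smul_eq_mul] at h
    exact (mul_right_cancel₀ hw h).symm
  exact degree_eq_of_pow_eq h

theorem degree_eq_of_coeff_dualVec {w : Word B N} {f : Forest d}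
    (hf : MvPolynomial.coeff f (dualVec hB w : H d) ≠ 0) :
    forestSize f = wordSize w.1 ∧ forestZeros f = wordZeros w.1 := by
  have h := degree_eq_of_Psi_ne_zero hB (IsBihomogeneous.lcoeff f) (w := w) (by
    rwa [← apply_dualVec])
  exact ⟨h.1.symm, h.2.symm⟩

theorem dualVec_mem (w : Word B N) : (dualVec hB w : H d) ∈ HN d (wordSize w.1) :=
  mem_HN_iff.2 fun _ hf => (degree_eq_of_coeff_dualVec hB hf).1.le

end

/-! ### The concatenation product -/

namespace TN

theorem word_val (w : Word B N) : word N w.1 = Finsupp.single w 1 := dif_pos w.2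

theorem pair_val (x : TN B N) (w : Word B N) : x.pair w.1 = x w := dif_pos w.2

theorem pair_add (x y : TN B N) (w : List B) : (x + y).pair w = x.pair w + y.pair w := by
  unfold pair
  split_ifs <;> simp

theorem pair_smul (a : ℝ) (x : TN B N) (w : List B) : (a • x).pair w = a * x.pair w := by
  unfold pair
  split_ifs <;> simp

theorem pair_zero (w : List B) : (0 : TN B N).pair w = 0 := by
  unfold pair
  split_ifs <;> simp

theorem pair_single [DecidableEq (List B)] (u : Word B N) (a : ℝ) (w : List B) :
    pair (Finsupp.single u a : TN B N) w = if u.1 = w then a else 0 := by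
  classical
  unfold pair
  by_cases h : wordSize w ≤ N
  · simp [h, Finsupp.single_apply, Subtype.ext_iff]
  · have h' : u.1 ≠ w := fun h' => h (h' ▸ u.2)
    simp [h, h']

theorem pair_word [DecidableEq (List B)] {u : List B} {w : List B} (hw : wordSize w ≤ N) :
    pair (word N u : TN B N) w = if u = w then 1 else 0 := by
  by_cases hu : wordSize u ≤ N
  · rw [word_val ⟨u, hu⟩, pair_single]
  · have h' : u ≠ w := fun h' => hu (h' ▸ hw)
    rw [word, dif_neg hu, pair_zero, if_neg h']

theorem add_concat (x y z : TN B N) : (x + y).concat z = x.concat z + y.concat z := by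
  unfold concat
  refine Finsupp.sum_add_index' (by simp) fun u a a' => ?_
  simp only [add_mul, add_smul, Finsupp.sum_add]

theorem concat_add (x y z : TN B N) : x.concat (y + z) = x.concat y + x.concat z := by
  unfold concat
  rw [← Finsupp.sum_add]
  refine Finsupp.sum_congr fun u _ => ?_
  exact Finsupp.sum_add_index' (by simp) (by simp [mul_add, add_smul])

theorem zero_concat (x : TN B N) : concat 0 x = 0 := Finsupp.sum_zero_index

theorem concat_zero (x : TN B N) : concat x 0 = 0 := by simp [concat]

theorem single_concat_single (u v : Word B N) (a c : ℝ) :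
    concat (Finsupp.single u a) (Finsupp.single v c) = (a * c) • word N (u.1 ++ v.1) := by
  unfold concat
  rw [Finsupp.sum_single_index (by simp), Finsupp.sum_single_index (by simp)]

theorem word_concat_word (u v : List B) :
    (word N u).concat (word N v) = word N (u ++ v) := by
  by_cases hu : wordSize u ≤ N
  · by_cases hv : wordSize v ≤ N
    · rw [word_val ⟨u, hu⟩, word_val ⟨v, hv⟩, single_concat_single, one_mul, one_smul]
    · have huv : ¬ wordSize (u ++ v) ≤ N := by
        rw [wordSize_append]
        omega
      rw [word, word, word, dif_neg hv, dif_neg huv, concat_zero]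
  · have huv : ¬ wordSize (u ++ v) ≤ N := by
      rw [wordSize_append]
      omega
    rw [word, word, word, dif_neg hu, dif_neg huv, zero_concat]

/-- The coefficients of a concatenation product are given by deconcatenation. -/
theorem pair_concat (x y : TN B N) {w : List B} (hw : wordSize w ≤ N) :
    (x.concat y).pair w =
      ∑ k ∈ Finset.range (w.length + 1), x.pair (w.take k) * y.pair (w.drop k) := by
  classical
  induction x using Finsupp.induction_linear with
  | zero => simp [zero_concat, pair_zero]
  | add x x' hx hx' =>
    simp only [add_concat, pair_add, hx, hx', add_mul, Finset.sum_add_distrib]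
  | single u a =>
    induction y using Finsupp.induction_linear with
    | zero => simp [concat_zero, pair_zero]
    | add y y' hy hy' =>
      simp only [concat_add, pair_add, hy, hy', mul_add, Finset.sum_add_distrib]
    | single v c =>
      simp only [single_concat_single, pair_smul, pair_word hw, pair_single]
      by_cases h : u.1 ++ v.1 = w
      · rw [if_pos h, Finset.sum_eq_single u.1.length]
        · simp [← h]
        · intro k hk hne
          rw [if_neg, zero_mul]
          intro h'
          have h'' := congrArg List.length h'
          rw [List.length_take, min_eq_left (Nat.lt_succ_iff.1 (Finset.mem_range.1 hk))] at h''
          exact hne h''.symm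
        · simp [← h]
      · rw [if_neg h, mul_zero]
        refine (Finset.sum_eq_zero fun k _ => ?_).symm
        by_cases h₁ : u.1 = w.take k
        · have h₂ : v.1 ≠ w.drop k := fun h₂ => h (by rw [h₁, h₂, List.take_append_drop])
          rw [if_neg h₂, mul_zero]
        · rw [if_neg h₁, zero_mul]

theorem sum_map_pair [DecidableEq (List B)] (x : TN B N) (s : Multiset (List B)) :
    (s.map x.pair).sum = x.sum fun w a => a * (s.count w.1 : ℝ) := by
  classical
  induction x using Finsupp.induction_linear with
  | zero => simp [pair_zero]
  | add x y hx hy =>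
    rw [Finsupp.sum_add_index' (by simp) (by simp [add_mul]), ← hx, ← hy, ← Multiset.sum_map_add]
    simp only [pair_add]
  | single u a =>
    rw [Finsupp.sum_single_index (by simp)]
    induction s using Multiset.induction_on with
    | empty => simp
    | cons w s ih =>
      rw [Multiset.map_cons, Multiset.sum_cons, ih, pair_single, Multiset.count_cons]
      split_ifs <;> push_cast <;> ring

theorem linearMap_ext {E : Type*} [AddCommMonoid E] [Module ℝ E] {T T' : TN B N →ₗ[ℝ] E}
    (h : ∀ w : List B, wordSize w ≤ N → T (word N w) = T' (word N w)) : T = T' := by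
  refine Finsupp.lhom_ext' fun w => LinearMap.ext_ring ?_
  have := h w.1 w.2
  rwa [word_val] at this

/-- Linear maps on `T_N(B)` which are multiplicative for concatenation are determined by their
values on letters. -/
theorem linearMap_ext_of_concat {T T' : TN B N →ₗ[ℝ] TN B N}
    (h₁ : T (word N []) = T' (word N [])) (hT : ∀ x y, T (x.concat y) = (T x).concat (T y))
    (hT' : ∀ x y, T' (x.concat y) = (T' x).concat (T' y))
    (h : ∀ b : B, T (word N [b]) = T' (word N [b])) : T = T' := by
  refine linearMap_ext fun w _ => ?_
  induction w with
  | nil => exact h₁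
  | cons b w ih =>
    have hw : wordSize w ≤ N := by
      rw [wordSize_cons] at *
      omega
    rw [← List.singleton_append, ← word_concat_word, hT, hT', h, ih hw]

end TN

theorem conv_add_left (X X' Y : HNdual d N) : conv (X + X') Y = conv X Y + conv X' Y := by
  simp only [conv, LinearMap.add_comp, LinearMap.comp_add, TensorProduct.map_add_left]

theorem conv_add_right (X Y Y' : HNdual d N) : conv X (Y + Y') = conv X Y + conv X Y' := by
  simp only [conv, LinearMap.add_comp, LinearMap.comp_add, TensorProduct.map_add_right]

theorem conv_smul_smul (a c : ℝ) (X Y : HNdual d N) :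
    conv (a • X) (c • Y) = (a * c) • conv X Y := by
  rw [← restrict_proj X, ← restrict_proj Y, ← map_smul, ← map_smul, ← restrict_convolve,
    convolve_smul_smul, map_smul, restrict_convolve]

variable (hB : IsStarBasis B N)

/-- `Ψ` is multiplicative. -/
theorem Psi_conv (X Y : HNdual d N) : Psi hB (conv X Y) = (Psi hB X).concat (Psi hB Y) := by
  obtain ⟨x, rfl⟩ := (Psi hB).symm.surjective X
  obtain ⟨y, rfl⟩ := (Psi hB).symm.surjective Y
  rw [LinearEquiv.apply_symm_apply, LinearEquiv.apply_symm_apply]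
  have hs : ∀ (u : Word B N) (a : ℝ),
      (Psi hB).symm (Finsupp.single u a) = a • restrict N (starFull u.1) := fun u a => by
    rw [Psi_symm_apply, Finsupp.sum_single_index (by simp), restrict_starFull]
  induction x using Finsupp.induction_linear with
  | zero =>
    have h := conv_smul_smul 0 1 (0 : HNdual d N) ((Psi hB).symm y)
    rw [zero_smul, zero_mul, zero_smul, one_smul] at h
    rw [map_zero, h, map_zero, TN.zero_concat]
  | add x x' hx hx' => rw [map_add, conv_add_left, map_add, hx, hx', TN.add_concat]
  | single u a =>
    induction y using Finsupp.induction_linear with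
    | zero =>
      have h := conv_smul_smul 1 0 ((Psi hB).symm (Finsupp.single u a)) (0 : HNdual d N)
      rw [zero_smul, mul_zero, zero_smul, one_smul] at h
      rw [map_zero, h, map_zero, TN.concat_zero]
    | add y y' hy hy' => rw [map_add, conv_add_right, map_add, hy, hy', TN.concat_add]
    | single v c =>
      rw [hs, hs, conv_smul_smul, ← restrict_convolve, ← starFull_append, map_smul,
        Psi_restrict_starFull, TN.single_concat_single]

/-! ### Characters -/

theorem finite_word (hB : IsStarBasis B N) : Finite (Word B N) :=
  Module.Finite.finite_basis (Module.Basis.mk hB.linearIndependent hB.spans)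

theorem apply_eq_sum {F : Module.Dual ℝ (H d)} {x : H d} (hx : x ∈ HN d N) :
    F x = (Psi hB (restrict N F)).sum fun w a => a * starFull w.1 x := by
  have h := Psi_symm_apply hB (Psi hB (restrict N F))
  rw [LinearEquiv.symm_apply_apply] at h
  have h' := LinearMap.congr_fun h ⟨x, hx⟩
  rw [restrict_apply] at h'
  rw [h', Finsupp.sum, LinearMap.sum_apply]
  refine Finset.sum_congr rfl fun w _ => ?_
  rw [← restrict_starFull]
  rfl

theorem apply_dualVec_eq_pair (F : Module.Dual ℝ (H d)) (w : Word B N) :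
    F (dualVec hB w) = (Psi hB (restrict N F)).pair w.1 := by
  rw [TN.pair_val, ← apply_dualVec, restrict_apply]

/-- Under the duality between forests and words, the forest product corresponds to the shuffle
product. -/
theorem apply_dualVec_mul (F : Module.Dual ℝ (H d)) {u v : Word B N}
    (h : wordSize u.1 + wordSize v.1 ≤ N) :
    F (dualVec hB u * dualVec hB v) =
      ((shuffle u.1 v.1).map (Psi hB (restrict N F)).pair).sum := by
  classical
  rw [apply_eq_sum hB (HN_mono h (mul_mem_HN (dualVec_mem hB u) (dualVec_mem hB v))),
    TN.sum_map_pair]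
  refine Finsupp.sum_congr fun w _ => ?_
  rw [count_shuffle, starFull_mul]
  simp only [starFull_dualVec]
  congr 1
  induction splits w.1 using Multiset.induction_on with
  | empty => simp
  | cons p s ih =>
    rw [Multiset.map_cons, Multiset.sum_cons, ih, Multiset.count_cons]
    by_cases h₁ : p.1 = u.1 <;> by_cases h₂ : p.2 = v.1 <;>
      simp [h₁, h₂, Prod.ext_iff, eq_comm, add_comm]

theorem HN_le_span_dualVec {m : ℕ} (hm : m ≤ N) :
    HN d m ≤ Submodule.span ℝ {x : H d | ∃ w : Word B N, wordSize w.1 ≤ m ∧ x = dualVec hB w} := by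
  classical
  intro x hx
  have := finite_word hB
  have := Fintype.ofFinite (Word B N)
  have hx' := HN_mono hm hx
  have h : (⟨x, hx'⟩ : HN d N) = ∑ w : Word B N, starFull w.1 x • dualVec hB w := by
    refine (Module.evalEquiv ℝ (HN d N)).injective ?_
    refine (Module.Basis.mk hB.linearIndependent hB.spans).ext fun u => ?_
    rw [Module.Basis.coe_mk, Module.evalEquiv_apply, Module.evalEquiv_apply, map_sum,
      ← restrict_starFull]
    simp [restrict_apply, starFull_dualVec, ← Subtype.ext_iff]
  have h' := congrArg Subtype.val h
  simp only [Submodule.coe_sum, Submodule.coe_smul] at h'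
  rw [h']
  refine Submodule.sum_mem _ fun w _ => ?_
  by_cases hw : wordSize w.1 ≤ m
  · exact Submodule.smul_mem _ _ (Submodule.subset_span ⟨w, hw, rfl⟩)
  · have h₀ := LinearMap.congr_fun
      (restrict_starFull_of_lt (N := m) hB.homogeneous (not_le.1 hw)) ⟨x, hx⟩
    rw [restrict_apply] at h₀
    rw [h₀, LinearMap.zero_apply, zero_smul]
    exact Submodule.zero_mem _

/-- A functional on `H_N` which corresponds under `Ψ` to a character of the shuffle algebra is
multiplicative for the forest product. -/
theorem map_mul_of_shuffle {F : Module.Dual ℝ (H d)}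
    (hF : ∀ u v : List B, wordSize u + wordSize v ≤ N →
      ((shuffle u v).map (Psi hB (restrict N F)).pair).sum =
        (Psi hB (restrict N F)).pair u * (Psi hB (restrict N F)).pair v)
    {m n : ℕ} (hmn : m + n ≤ N) {x y : H d} (hx : x ∈ HN d m) (hy : y ∈ HN d n) :
    F (x * y) = F x * F y := by
  have hx' := HN_le_span_dualVec hB (by omega) hx
  have hy' := HN_le_span_dualVec hB (by omega) hy
  clear hx hy
  induction hx' using Submodule.span_induction with
  | zero => simp
  | add x x' _ _ hx hx' => rw [add_mul, map_add, map_add, hx, hx', add_mul]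
  | smul a x _ hx => rw [smul_mul_assoc, map_smul, map_smul, hx, smul_mul_assoc]
  | mem x hx =>
    obtain ⟨u, hu, rfl⟩ := hx
    induction hy' using Submodule.span_induction with
    | zero => simp
    | add y y' _ _ hy hy' => rw [mul_add, map_add, map_add, hy, hy', mul_add]
    | smul a y _ hy => rw [mul_smul_comm, map_smul, map_smul, hy, mul_smul_comm]
    | mem y hy =>
      obtain ⟨v, hv, rfl⟩ := hy
      rw [apply_dualVec_mul hB F (by omega), hF _ _ (by omega), apply_dualVec_eq_pair,
        apply_dualVec_eq_pair]

theorem dualVec_nil (h : wordSize ([] : List B) ≤ N) :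
    (dualVec hB ⟨[], h⟩ : H d) = 1 := by
  classical
  have h₁ := starFull_dualVec hB [] ⟨[], h⟩
  rw [if_pos rfl, starFull_nil, AlgHom.toLinearMap_apply, counitHom_apply] at h₁
  refine MvPolynomial.ext _ _ fun f => ?_
  rw [MvPolynomial.coeff_one]
  split_ifs with hf
  · rw [← hf, h₁]
  · by_contra hne
    have h₂ : forestSize f = 0 := (degree_eq_of_coeff_dualVec hB hne).1
    refine hf (Finsupp.ext fun τ => ?_)
    by_contra h0
    have h₃ : f τ * τ.size ≤ forestSize f :=
      Finset.single_le_sum (f := fun τ => f τ * τ.size) (fun _ _ => Nat.zero_le _)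
        (Finsupp.mem_support_iff.2 (Ne.symm h0))
    have h₄ := τ.one_le_size
    have h₅ : 0 < f τ * τ.size := Nat.mul_pos (Nat.pos_of_ne_zero (Ne.symm h0)) h₄
    omega

/-! ### Renormalisation maps -/

/-- The span of the forests with at most `n` nodes and exponent at least `e`. -/
def exponentSpan (d : ℕ) (γ : ℝ) (n : ℕ) (e : ℝ) : Submodule ℝ (H d) :=
  Submodule.span ℝ {x | ∃ f : Forest d, forestSize f ≤ n ∧
    e ≤ exponent γ (forestSize f) (forestZeros f) ∧ x = MvPolynomial.monomial f 1}

theorem exponentSpan_le_HN (γ : ℝ) (n : ℕ) (e : ℝ) : exponentSpan d γ n e ≤ HN d n :=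
  Submodule.span_mono fun _ ⟨f, hf, _, hx⟩ => ⟨f, hf, hx⟩

theorem exponent_add (γ : ℝ) (n z n' z' : ℕ) :
    exponent γ (n + n') (z + z') = exponent γ n z + exponent γ n' z' := by
  simp only [exponent, Nat.cast_add]
  ring

theorem mul_mem_exponentSpan {γ e e' : ℝ} {n n' : ℕ} {x y : H d} (hx : x ∈ exponentSpan d γ n e)
    (hy : y ∈ exponentSpan d γ n' e') : x * y ∈ exponentSpan d γ (n + n') (e + e') := by
  refine (Submodule.mul_le.1 ?_) x hx y hy
  rw [exponentSpan, exponentSpan, Submodule.span_mul_span]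
  refine Submodule.span_le.2 ?_
  rintro _ ⟨_, ⟨f, hf, hf', rfl⟩, _, ⟨g, hg, hg', rfl⟩, rfl⟩
  refine Submodule.subset_span ⟨f + g, ?_, ?_, by simp⟩
  · rw [forestSize_add]
    exact add_le_add hf hg
  · rw [forestSize_add, forestZeros_add, exponent_add]
    exact add_le_add hf' hg'

namespace IsRenormalisation

variable {γ : ℝ} {M : H d →ₐ[ℝ] H d}

theorem map_monomial_mem (hM : IsRenormalisation γ M) (f : Forest d) :
    M (MvPolynomial.monomial f 1) ∈
      exponentSpan d γ (forestSize f) (exponent γ (forestSize f) (forestZeros f)) := by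
  have h₁ : (1 : H d) ∈ exponentSpan d γ 0 (exponent γ 0 0) :=
    Submodule.subset_span ⟨0, by simp [forestSize_zero],
      by simp [forestSize_zero, forestZeros_zero], by simp⟩
  have hτ : ∀ τ : DTree d, M (tree τ) ∈ exponentSpan d γ τ.size (exponent γ τ.size τ.zeros) := by
    intro τ
    refine Submodule.span_mono ?_ (hM.analytic τ)
    rintro _ ⟨σ, hσ, hσ', rfl⟩
    refine ⟨Finsupp.single σ 1, ?_, ?_, rfl⟩
    · rwa [forestSize_single, one_mul]
    · rwa [forestSize_single, forestZeros_single, one_mul, one_mul]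
  induction f using Finsupp.induction_linear with
  | zero => simpa [forestSize_zero, forestZeros_zero] using h₁
  | add f g hf hg =>
    have h : (MvPolynomial.monomial (f + g) 1 : H d) =
        MvPolynomial.monomial f 1 * MvPolynomial.monomial g 1 := by simp
    rw [h, map_mul, forestSize_add, forestZeros_add, exponent_add]
    exact mul_mem_exponentSpan hf hg
  | single τ n =>
    have h : (MvPolynomial.monomial (Finsupp.single τ n) 1 : H d) = tree τ ^ n := by
      rw [tree, MvPolynomial.X_pow_eq_monomial]
    rw [h, map_pow, forestSize_single, forestZeros_single]
    clear h
    induction n with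
    | zero => simpa using h₁
    | succ n ih =>
      rw [pow_succ, Nat.succ_mul, Nat.succ_mul, exponent_add]
      exact mul_mem_exponentSpan ih (hτ τ)

theorem map_mem_HN (hM : IsRenormalisation γ M) {n : ℕ} {x : H d} (hx : x ∈ HN d n) :
    M x ∈ HN d n := by
  have h : HN d n ≤ (HN d n).comap M.toLinearMap := by
    refine Submodule.span_le.2 ?_
    rintro _ ⟨f, hf, rfl⟩
    exact HN_mono hf (exponentSpan_le_HN _ _ _ (hM.map_monomial_mem f))
  exact h hx

theorem counit_comp (hM : IsRenormalisation γ M) :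
    (counitHom d).toLinearMap ∘ₗ M.toLinearMap = (counitHom d).toLinearMap := by
  have h : (counitHom d).comp M = counitHom d := by
    refine MvPolynomial.algHom_ext fun τ => ?_
    have hle : Submodule.span ℝ {x : H d | ∃ σ : DTree d, τ.exponent γ ≤ σ.exponent γ ∧
        σ.size ≤ τ.size ∧ x = tree σ} ≤ LinearMap.ker (counitHom d).toLinearMap := by
      refine Submodule.span_le.2 ?_
      rintro _ ⟨σ, _, _, rfl⟩
      exact counitHom_tree σ
    exact (hle (hM.analytic τ)).trans (counitHom_tree τ).symm
  rw [← AlgHom.comp_toLinearMap, h]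

/-- The matrix of the adjoint in the basis of words is triangular with respect to the exponents. -/
theorem exponent_le (hM : IsRenormalisation γ M) {u : List B} {w : Word B N}
    (h : starFull u (M (dualVec hB w)) ≠ 0) : wordExponent γ w.1 ≤ wordExponent γ u := by
  by_contra hlt
  have hmem : M (dualVec hB w) ∈ exponentSpan d γ (wordSize w.1) (wordExponent γ w.1) := by
    rw [MvPolynomial.as_sum (dualVec hB w : H d), map_sum]
    refine Submodule.sum_mem _ fun f hf => ?_
    obtain ⟨h₁, h₂⟩ := degree_eq_of_coeff_dualVec hB (MvPolynomial.mem_support_iff.1 hf)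
    have hm := Submodule.smul_mem _ (MvPolynomial.coeff f (dualVec hB w : H d))
      (hM.map_monomial_mem f)
    rw [h₁, h₂, ← wordExponent_eq, ← map_smul, MvPolynomial.smul_monomial, smul_eq_mul,
      mul_one] at hm
    exact hm
  have hle : exponentSpan d γ (wordSize w.1) (wordExponent γ w.1) ≤
      LinearMap.ker (starFull u) := by
    refine Submodule.span_le.2 ?_
    rintro _ ⟨f, _, hf, rfl⟩
    by_contra hne
    obtain ⟨h₁, h₂⟩ := (isBihomogeneous_starFull hB.homogeneous u).degree_eq hne
    rw [h₁, h₂, ← wordExponent_eq] at hf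
    exact hlt hf
  exact h (hle hmem)

end IsRenormalisation

theorem wordExponent_nonneg {γ : ℝ} (hγ₀ : 0 ≤ γ) (hγ₁ : γ ≤ 1) (w : List B) :
    0 ≤ wordExponent γ w := by
  rw [wordExponent_eq, exponent]
  have h₁ : 0 ≤ 1 - γ := sub_nonneg.2 hγ₁
  positivity

/-- The adjoint of `M`, transported to `T_N(B)` along `Ψ`. -/
def translation (M : H d →ₐ[ℝ] H d) : TN B N →ₗ[ℝ] TN B N :=
  (Psi hB).toLinearMap ∘ₗ adjoint N M ∘ₗ (Psi hB).symm.toLinearMap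

theorem translation_Psi (M : H d →ₐ[ℝ] H d) (X : HNdual d N) :
    translation hB M (Psi hB X) = Psi hB (adjoint N M X) := by
  simp [translation]

section

variable {γ : ℝ} {M : H d →ₐ[ℝ] H d}

theorem translation_Psi_restrict (hM : IsRenormalisation γ M) (F : Module.Dual ℝ (H d)) :
    translation hB M (Psi hB (restrict N F)) = Psi hB (restrict N (F ∘ₗ M.toLinearMap)) := by
  rw [translation_Psi, adjoint_restrict fun x hx => hM.map_mem_HN hx]

theorem translation_nil (hM : IsRenormalisation γ M) :
    translation hB M (TN.word N []) = TN.word N [] := by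
  rw [← Psi_restrict_starFull hB, translation_Psi_restrict hB hM, starFull_nil, hM.counit_comp]

theorem translation_concat (hM : IsRenormalisation γ M) (x y : TN B N) :
    translation hB M (x.concat y) = (translation hB M x).concat (translation hB M y) := by
  obtain ⟨X, rfl⟩ := (Psi hB).surjective x
  obtain ⟨Y, rfl⟩ := (Psi hB).surjective y
  rw [← Psi_conv, translation_Psi, translation_Psi, translation_Psi,
    adjoint_conv (fun x hx => hM.map_mem_HN hx) hM.cointeraction, Psi_conv]

theorem translation_letter (M : H d →ₐ[ℝ] H d) (b : B) :
    translation hB M (TN.word N [b]) = Psi hB (adjoint N M (toDual N b.1)) := by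
  rw [← Psi_restrict_starFull hB, translation_Psi, starFull_singleton, restrict_letter]

theorem exists_functional (x : TN B N) : ∃ F, Psi hB (restrict N F) = x :=
  ⟨(Psi hB).symm x ∘ₗ proj d N, by rw [restrict_proj, LinearEquiv.apply_symm_apply]⟩

theorem translation_pair (hM : IsRenormalisation γ M) [Fintype (Word B N)] (x : TN B N)
    (w : Word B N) : (translation hB M x).pair w.1 =
      ∑ u : Word B N, x u * starFull u.1 (M (dualVec hB w)) := by
  obtain ⟨F, rfl⟩ := exists_functional hB x
  rw [translation_Psi_restrict hB hM, ← apply_dualVec_eq_pair, LinearMap.comp_apply,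
    AlgHom.toLinearMap_apply, apply_eq_sum hB (hM.map_mem_HN (dualVec hB w).2),
    Finsupp.sum_fintype _ _ (by simp)]

theorem translation_isARP (hγ₀ : 0 < γ) (hγ₁ : γ < 1) (hM : IsRenormalisation γ M)
    {X : unitInterval → unitInterval → TN B N} (hX : IsARP γ X) :
    IsARP γ fun s t => translation hB M (X s t) where
  unit s t := by
    obtain ⟨F, hF⟩ := exists_functional hB (X s t)
    have h := hX.unit s t
    have h₀ : wordSize ([] : List B) ≤ N := Nat.zero_le _
    rw [← hF, ← apply_dualVec_eq_pair hB F ⟨[], h₀⟩, dualVec_nil] at h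
    rw [← hF, translation_Psi_restrict hB hM, ← apply_dualVec_eq_pair hB _ ⟨[], h₀⟩, dualVec_nil,
      LinearMap.comp_apply, AlgHom.toLinearMap_apply, map_one, h]
  mul s t u v huv := by
    obtain ⟨F, hF⟩ := exists_functional hB (X s t)
    have h := hX.mul s t
    rw [← hF] at h
    rw [← hF, translation_Psi_restrict hB hM]
    let u' : Word B N := ⟨u, by omega⟩
    let v' : Word B N := ⟨v, by omega⟩
    rw [← apply_dualVec_mul hB _ (u := u') (v := v') huv, ← apply_dualVec_eq_pair hB _ u',
      ← apply_dualVec_eq_pair hB _ v', LinearMap.comp_apply, LinearMap.comp_apply,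
      LinearMap.comp_apply, AlgHom.toLinearMap_apply, AlgHom.toLinearMap_apply,
      AlgHom.toLinearMap_apply, map_mul]
    exact map_mul_of_shuffle hB h huv (hM.map_mem_HN (dualVec_mem hB u'))
      (hM.map_mem_HN (dualVec_mem hB v'))
  diag t := by rw [hX.diag, translation_nil hB hM]
  chen s r t w hw := by
    have h : (X s r).concat (X r t) = X s t := by
      refine Finsupp.ext fun w => ?_
      rw [← TN.pair_val, ← TN.pair_val, TN.pair_concat _ _ w.2, hX.chen s r t w.1 w.2]
    rw [← TN.pair_concat _ _ hw, ← translation_concat hB hM, h]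
  bound w hw := by
    have := finite_word hB
    have := Fintype.ofFinite (Word B N)
    choose C hC using fun u : Word B N => hX.bound u.1 u.2
    let k (u : Word B N) : ℝ := starFull u.1 (M (dualVec hB ⟨w, hw⟩))
    refine ⟨∑ u, |C u| * |k u|, fun s t => ?_⟩
    rw [translation_pair hB hM (X s t) ⟨w, hw⟩, Finset.sum_mul]
    refine (Finset.abs_sum_le_sum_abs _ _).trans (Finset.sum_le_sum fun u _ => ?_)
    rw [abs_mul]
    change |X s t u| * |k u| ≤ _
    by_cases hk : k u = 0
    · simp [hk]
    have ht : |(t : ℝ) - s| ≤ 1 := by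
      rw [abs_le]
      constructor <;> linarith [t.2.1, t.2.2, s.2.1, s.2.2]
    have hpow : |(t : ℝ) - s| ^ wordExponent γ u.1 ≤ |(t : ℝ) - s| ^ wordExponent γ w :=
      Real.rpow_le_rpow_of_exponent_ge' (abs_nonneg _) ht
        (wordExponent_nonneg hγ₀.le hγ₁.le w) (hM.exponent_le hB hk)
    have h := hC u s t
    rw [TN.pair_val] at h
    calc |X s t u| * |k u| ≤ (|C u| * |(t : ℝ) - s| ^ wordExponent γ w) * |k u| := by
          gcongr
          refine h.trans ?_
          gcongr
          exact le_abs_self _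
      _ = |C u| * |k u| * |(t : ℝ) - s| ^ wordExponent γ w := by ring

end

end BranchedRP

end

theorem proposition3p4 (d : ℕ) (γ : ℝ) (hγ₀ : 0 < γ) (hγ₁ : γ < 1)
    (N : ℕ) (hN : IsGreatest {n : ℕ | γ * n ≤ 1} N)
    (B : Set (BranchedRP.DTree d →₀ ℝ)) (hB : BranchedRP.IsStarBasis B N)
    (M : BranchedRP.H d →ₐ[ℝ] BranchedRP.H d) (hM : BranchedRP.IsRenormalisation γ M) :
    ∃ T : BranchedRP.TN B N →ₗ[ℝ] BranchedRP.TN B N,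
      -- `T` is multiplicative for concatenation, with prescribed values on letters
      (T (BranchedRP.TN.word N []) = BranchedRP.TN.word N [] ∧
        (∀ x y, T (x.concat y) = (T x).concat (T y)) ∧
        ∀ b : B, T (BranchedRP.TN.word N [b]) =
          BranchedRP.Psi hB (BranchedRP.adjoint N M (BranchedRP.toDual N b.1))) ∧
      -- and it is the only such map
      (∀ T' : BranchedRP.TN B N →ₗ[ℝ] BranchedRP.TN B N,
        (T' (BranchedRP.TN.word N []) = BranchedRP.TN.word N [] ∧
          (∀ x y, T' (x.concat y) = (T' x).concat (T' y)) ∧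
          ∀ b : B, T' (BranchedRP.TN.word N [b]) =
            BranchedRP.Psi hB (BranchedRP.adjoint N M (BranchedRP.toDual N b.1))) → T' = T) ∧
      -- the diagram commutes, and `T` is the only map for which it does
      (∀ X, BranchedRP.Psi hB (BranchedRP.adjoint N M X) = T (BranchedRP.Psi hB X)) ∧
      (∀ T' : BranchedRP.TN B N →ₗ[ℝ] BranchedRP.TN B N,
        (∀ X, BranchedRP.Psi hB (BranchedRP.adjoint N M X) = T' (BranchedRP.Psi hB X)) → T' = T) ∧
      -- `T` maps anisotropic rough paths to anisotropic rough paths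
      (∀ X : unitInterval → unitInterval → BranchedRP.TN B N,
        BranchedRP.IsARP γ X → BranchedRP.IsARP γ fun s t => T (X s t)) := by
  refine ⟨BranchedRP.translation hB M, ⟨BranchedRP.translation_nil hB hM,
    BranchedRP.translation_concat hB hM, BranchedRP.translation_letter hB M⟩, ?_, ?_, ?_, ?_⟩
  · rintro T' ⟨h₁, h₂, h₃⟩
    refine BranchedRP.TN.linearMap_ext_of_concat ?_ h₂
      (BranchedRP.translation_concat hB hM) fun b => ?_
    · rw [h₁, BranchedRP.translation_nil hB hM]
    · rw [h₃, BranchedRP.translation_letter]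
  · exact fun X => (BranchedRP.translation_Psi hB M X).symm
  · intro T' hT'
    refine LinearMap.ext fun x => ?_
    obtain ⟨X, rfl⟩ := (BranchedRP.Psi hB).surjective x
    rw [← hT', BranchedRP.translation_Psi]
  · exact fun X hX => BranchedRP.translation_isARP hB hγ₀ hγ₁ hM hX
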